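/- Let $\nu>0$, $\sigma>0$, $\beta_0,\beta_1\in\mathbb R$, and consider the simple linear regression $y_i=\beta_0+\beta_1z_i+\varepsilon_i$, $i=1,2,\dots$, where the covariates $z_i$ are i.i.d. with Student's $t_\nu$ distribution and, for every $n$, given $Z=(z_1,\dots,z_n)$ the errors $\varepsilon_1,\dots,\varepsilon_n$ have mean $0$, variance $\sigma^2$ and are uncorrelated. Put $x_i=(1,z_i)^{\rm T}$. For random $V_n$ and numbers $a_n>0$ write $V_n\asymp_P a_n$ if for every $\epsilon>0$ there are constants $0<c\le C<\infty$ such that $P(c\,a_n\le V_n\le C\,a_n)\ge1-\epsilon$ for all large $n$. All limits are for $n\to\infty$ with the subdata size $k$ fixed. "Uniformly in $k$" means that the constants $c,C$ can be chosen independently of $k$ (how large $n$ must be may depend on $k$). (a) IBOSS. Let $k=2r$, $r\ge1$, and let $\hat\beta^{\rm D}$ be the least-squares estimator from the subdata consisting of the $r$ data points with the smallest and the $r$ data points with the largest values of $z_i$, $1\le i\le n$ (ties broken by any rule that depends on $Z$ only). Then $$V(\hat\beta^{\rm D}_0\mid Z)\asymp_P\frac1k\ \text{ uniformly in }k,\qquad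 V(\hat\beta^{\rm D}_1\mid Z)\asymp_P\frac1{k\,n^{2/\nu}}\ \text{ for each fixed } k,$$ and in the second relation the lower constant $c$ can be chosen independently of $k$. (b) Uniform subsampling (UNI). Let $k\ge2$, draw $k$ of the $n$ data points uniformly, with or without replacement and independently of the errors, let $\eta_i$ be the number of times that point $i$ is drawn, let $\Delta$ be the event that $\sum_i\eta_ix_ix_i^{\rm T}$ is non-singular, and let $\tilde\beta=(\sum_i\eta_ix_ix_i^{\rm T})^{-1}\sum_i\eta_ix_iy_i$. Put $$B=\frac{\sigma^2P(\Delta\mid Z)}{k}\Big(\frac1n\sum_{i=1}^nx_ix_i^{\rm T}\Big)^{-1},$$ with diagonal entries $B_{00}$ and $B_{11}$ belonging to the intercept and the slope. Then, for $2\le k\le n$, almost surely $V(\tilde\beta_j\mid Z,\Delta)\ge B_{jj}$ for $j=0,1$. Moreover $B_{00}\asymp_P1/k$ uniformly in $k$; if $\nu>2$, then $B_{11}\asymp_P1/k$ uniformly in $k$; if $\nu\le2$, then for every $\alpha>0$ and every $k\ge 2$, $B_{11}$ is of an order slower than $1/(k\,n^{2/\nu-1+\alpha})$, in the sense that $k\,n^{2/\nu-1+\alpha}B_{11}\to\infty$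 almost surely. (c) Full data. Let $\hat\beta_f$ be the least-squares estimator from all $n$ data points. Then $V(\hat\beta_{f,0}\mid Z)\asymp_P1/n$; if $\nu>2$, then $V(\hat\beta_{f,1}\mid Z)\asymp_P1/n$; if $\nu\le2$, then for every $\alpha>0$ the variance $V(\hat\beta_{f,1}\mid Z)$ decays slower than $n^{-(2/\nu+\alpha)}$, in the sense that $n^{2/\nu+\alpha}\,V(\hat\beta_{f,1}\mid Z)\to\infty$ almost surely. -/

import Mathlib

open MeasureTheory ProbabilityTheory Filter Topology

noncomputable section

/-- Density of Student's `t` distribution with `ν` degrees of freedom. -/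
def studentTDensity (ν x : ℝ) : ℝ :=
  Real.Gamma ((ν + 1) / 2) / (Real.sqrt (ν * Real.pi) * Real.Gamma (ν / 2)) *
    (1 + x ^ 2 / ν) ^ (-((ν + 1) / 2))

/-- Student's `t` distribution with `ν` degrees of freedom. -/
def studentT (ν : ℝ) : Measure ℝ :=
  volume.withDensity fun x => ENNReal.ofReal (studentTDensity ν x)

/-- `V n ≍_P a n`: the ratio `V n / a n` is bounded away from `0` and `∞` in probability. -/
def OrderInProb {Ω : Type*} [MeasurableSpace Ω] (μ : Measure Ω)
    (V : ℕ → Ω → ℝ) (a : ℕ → ℝ) : Prop :=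
  ∀ ε : ℝ, 0 < ε → ∃ c C : ℝ, 0 < c ∧ 0 < C ∧ ∀ᶠ n : ℕ in atTop,
    μ {ω | ¬ (c * a n ≤ V n ω ∧ V n ω ≤ C * a n)} ≤ ENNReal.ofReal ε

/-- For every `k ∈ K`, `V k n ≍_P a k n` as `n → ∞`, with constants that do not depend on `k`. -/
def UniformOrderInProb {Ω : Type*} [MeasurableSpace Ω] (μ : Measure Ω) (K : Set ℕ)
    (V : ℕ → ℕ → Ω → ℝ) (a : ℕ → ℕ → ℝ) : Prop :=
  ∀ ε : ℝ, 0 < ε → ∃ c C : ℝ, 0 < c ∧ 0 < C ∧ ∀ k ∈ K, ∀ᶠ n : ℕ in atTop,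
    μ {ω | ¬ (c * a k n ≤ V k n ω ∧ V k n ω ≤ C * a k n)} ≤ ENNReal.ofReal ε

/-- For every `k ∈ K`, `a k n = O_P(V k n)` as `n → ∞`, with a constant that does not depend
on `k`. -/
def UniformLowerOrderInProb {Ω : Type*} [MeasurableSpace Ω] (μ : Measure Ω) (K : Set ℕ)
    (V : ℕ → ℕ → Ω → ℝ) (a : ℕ → ℕ → ℝ) : Prop :=
  ∀ ε : ℝ, 0 < ε → ∃ c : ℝ, 0 < c ∧ ∀ k ∈ K, ∀ᶠ n : ℕ in atTop,
    μ {ω | V k n ω < c * a k n} ≤ ENNReal.ofReal ε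

/-- The regressor `x = (1, z)`. -/
def regressor (t : ℝ) : Fin 2 → ℝ := ![1, t]

/-- `∑ i, w i • x i (x i)ᵀ`. -/
def gramMatrix {n : ℕ} (z w : Fin n → ℝ) : Matrix (Fin 2) (Fin 2) ℝ :=
  ∑ i, w i • Matrix.vecMulVec (regressor (z i)) (regressor (z i))

/-- Weighted least-squares estimator `(∑ w i x i (x i)ᵀ)⁻¹ ∑ w i x i y i` of `(β₀, β₁)`.
Weights `1` give the full-data estimator, the indicator of a set of indices gives the
subdata estimator, multiplicities of a subsample give the unweighted subsampling estimator. -/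
def lsEstimator {n : ℕ} (z w y : Fin n → ℝ) : Fin 2 → ℝ :=
  (gramMatrix z w)⁻¹.mulVec (∑ i, (w i * y i) • regressor (z i))

/-- Responses `y i = β₀ + β₁ z i + e i`. -/
def response {n : ℕ} (b : Fin 2 → ℝ) (z e : Fin n → ℝ) : Fin n → ℝ :=
  fun i => b 0 + b 1 * z i + e i

/-- The first `n` terms of a sequence of random variables, as a random vector. -/
def firstTerms {Ω : Type*} (z : ℕ → Ω → ℝ) (n : ℕ) (ω : Ω) : Fin n → ℝ := fun i => z i ω

/-- The errors of a linear model: given the covariates `z 0, …, z (n - 1)`, the errors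
`e 0, …, e (n - 1)` have mean `0`, variance `σ ^ 2`, and are uncorrelated. -/
def IsRegressionError {Ω : Type*} [MeasurableSpace Ω] (μ : Measure Ω) (σ : ℝ)
    (z e : ℕ → Ω → ℝ) : Prop :=
  (∀ i, Measurable (e i)) ∧ (∀ i, MemLp (e i) 2 μ) ∧
  ∀ n i j : ℕ, i < n → j < n →
    μ[e i | MeasurableSpace.comap (firstTerms z n) inferInstance] =ᵐ[μ] 0 ∧
    μ[fun ω => e i ω * e j ω | MeasurableSpace.comap (firstTerms z n) inferInstance]
      =ᵐ[μ] fun _ => if i = j then σ ^ 2 else 0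

/-- The conditional law of the errors of the full data of size `n` given its covariates,
at the observed covariates. -/
def errorLaw {Ω : Type*} [MeasurableSpace Ω] (μ : Measure Ω) [IsFiniteMeasure μ]
    (z e : ℕ → Ω → ℝ) (n : ℕ) (ω : Ω) : Measure (Fin n → ℝ) :=
  condDistrib (firstTerms e n) (firstTerms z n) μ (firstTerms z n ω)

/-- `V(β̂_j | Z)` for the least-squares estimator whose weights `w` depend on the
covariates only. -/
def lsCondVar {Ω : Type*} [MeasurableSpace Ω] (μ : Measure Ω) [IsFiniteMeasure μ]
    (z e : ℕ → Ω → ℝ) (b : Fin 2 → ℝ) (n : ℕ) (w : (Fin n → ℝ) → Fin n → ℝ) (j : Fin 2)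
    (ω : Ω) : ℝ :=
  variance (fun u => lsEstimator (firstTerms z n ω) (w (firstTerms z n ω))
    (response b (firstTerms z n ω) u) j) (errorLaw μ z e n ω)

/-- `V(β̂_j | Z)` for the full-data estimator. -/
def fullCondVar {Ω : Type*} [MeasurableSpace Ω] (μ : Measure Ω) [IsFiniteMeasure μ]
    (z e : ℕ → Ω → ℝ) (b : Fin 2 → ℝ) (j : Fin 2) (n : ℕ) (ω : Ω) : ℝ :=
  lsCondVar μ z e b n (fun _ _ => 1) j ω

/-- `s` consists of `r` indices with the `r` smallest values of `z` and `r` further indices with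
the `r` largest values (ties broken in any way). -/
def IsExtremeSubdata {n : ℕ} (r : ℕ) (z : Fin n → ℝ) (s : Finset (Fin n)) : Prop :=
  ∃ L U : Finset (Fin n), Disjoint L U ∧ s = L ∪ U ∧ L.card = r ∧ U.card = r ∧
    (∀ i ∈ L, ∀ j, j ∉ L → z i ≤ z j) ∧ (∀ i ∈ U, ∀ j, j ∉ U → z j ≤ z i)

/-- A selection rule of the D-optimality motivated algorithm for one covariate: from the
covariates of full data of size `n` it selects subdata of size `k = 2 * r`. -/
def IsIBOSSRule (sel : (r n : ℕ) → (Fin n → ℝ) → Finset (Fin n)) : Prop :=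
  ∀ r n z, 1 ≤ r → 2 * r ≤ n → IsExtremeSubdata r z (sel r n z)

/-- `V(β̂_j^D | Z)` for the estimator from IBOSS subdata of size `2 * r`. -/
def ibossCondVar {Ω : Type*} [MeasurableSpace Ω] (μ : Measure Ω) [IsFiniteMeasure μ]
    (z e : ℕ → Ω → ℝ) (b : Fin 2 → ℝ) (sel : (r n : ℕ) → (Fin n → ℝ) → Finset (Fin n))
    (j : Fin 2) (r n : ℕ) (ω : Ω) : ℝ :=
  lsCondVar μ z e b n (fun Z i => if i ∈ sel r n Z then 1 else 0) j ω

/-- Law of `k` successive uniform draws from `n` data points, with replacement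
(`repl = true`) or without replacement (`repl = false`). -/
def uniformDraws (repl : Bool) (n k : ℕ) : Measure (Fin k → Fin n) :=
  uniformOn {d | repl = true ∨ Function.Injective d}

/-- The count vector: how often each data point is drawn. -/
def drawCounts {n k : ℕ} (d : Fin k → Fin n) : Fin n → ℝ :=
  fun i => ((Finset.univ.filter fun l => d l = i).card : ℝ)

/-- The draws for which the subsample has a full-rank covariate matrix. -/
def fullRankDraws {n : ℕ} (k : ℕ) (z : Fin n → ℝ) : Set (Fin k → Fin n) :=
  {d | IsUnit (gramMatrix z (drawCounts d))}

/-- `V(β̃_j | Z, full rank)` for the uniform subsampling estimator. The draws are independent of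
the errors, so given `Z` and full rank the pair (errors, draws) has a product law. -/
def uniCondVar {Ω : Type*} [MeasurableSpace Ω] (μ : Measure Ω) [IsFiniteMeasure μ]
    (z e : ℕ → Ω → ℝ) (b : Fin 2 → ℝ) (repl : Bool) (j : Fin 2) (k n : ℕ) (ω : Ω) : ℝ :=
  variance (fun p : (Fin n → ℝ) × (Fin k → Fin n) =>
      lsEstimator (firstTerms z n ω) (drawCounts p.2) (response b (firstTerms z n ω) p.1) j)
    ((errorLaw μ z e n ω).prod
      (ProbabilityTheory.cond (uniformDraws repl n k) (fullRankDraws k (firstTerms z n ω))))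

/-- The `j`-th diagonal entry of the lower bound
`(σ² P(full rank | Z) / k) (n⁻¹ ∑ x i (x i)ᵀ)⁻¹` for the covariance matrix of the uniform
subsampling estimator. -/
def uniLowerBound {Ω : Type*} (σ : ℝ) (z : ℕ → Ω → ℝ) (repl : Bool) (j : Fin 2) (k n : ℕ)
    (ω : Ω) : ℝ :=
  σ ^ 2 * (uniformDraws repl n k).real (fullRankDraws k (firstTerms z n ω)) / k *
    (gramMatrix (firstTerms z n ω) (fun _ => 1 / (n : ℝ)))⁻¹ j j

end

/-! ### Algebra of the least-squares estimator -/

section Algebra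

variable {n : ℕ}

/-! Given the covariates, a least-squares estimator with 0/1 weights has variance `σ ^ 2` times a
diagonal entry of the inverse Gram matrix. With s₀ = ∑ w, s₁ = ∑ w z, s₂ = ∑ w z² these entries are
s₂ / (s₀ s₂ - s₁²) and s₀ / (s₀ s₂ - s₁²). Once s₁² ≤ θ s₀ s₂ with θ < 1, they agree with 1 / s₀ and
1 / s₂ up to the factor 1 / (1 - θ) (`div_sub_sq_bounds`), so only s₂ remains to be sized.

The strict form of Cauchy–Schwarz must hold without moments, since for small ν the covariates have
no mean. It comes from signs: negative and positive terms partly cancel, so Cauchy–Schwarz is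
applied to each sign separately (`sq_sum_le_of_sign`), and the law of large numbers for indicators
keeps each sign below a proportion θ of the sample. In IBOSS subdata the two tails eventually have
opposite signs and θ = 1/2 works.

Size of s₂: for IBOSS it lies between max z² and k max z², and max |z| has order n^(1/ν) by the
polynomial tails. For all data and ν > 2 it is of order n by the law of large numbers. For ν ≤ 2,
subadditivity of x ↦ x^q reduces it to a law of large numbers for |z|^(2q) with 2q < ν
(`ae_tendsto_rpow_div_sum_sq`).

For uniform subsampling, a quadratic lower bound for the variance, linear in the counts, is averaged
over the draws, whose expected counts are k / n by exchangeability; optimizing its free vector gives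
the bound B. The probability of full rank stays in [1/2, 1], because almost surely the covariates
are distinct and two draws differ with probability at least 1/2. -/

lemma gramMatrix_eq (z w : Fin n → ℝ) :
    gramMatrix z w = !![∑ i, w i, ∑ i, w i * z i; ∑ i, w i * z i, ∑ i, w i * z i ^ 2] := by
  ext a c
  fin_cases a <;> fin_cases c <;>
    simp [gramMatrix, Matrix.sum_apply, regressor, pow_two]

lemma gramMatrix_det (z w : Fin n → ℝ) :
    (gramMatrix z w).det = (∑ i, w i) * (∑ i, w i * z i ^ 2) - (∑ i, w i * z i) ^ 2 := by
  rw [gramMatrix_eq, Matrix.det_fin_two_of]; ring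

lemma gramMatrix_inv_zero (z w : Fin n → ℝ) :
    (gramMatrix z w)⁻¹ 0 0 = (∑ i, w i * z i ^ 2) /
      ((∑ i, w i) * (∑ i, w i * z i ^ 2) - (∑ i, w i * z i) ^ 2) := by
  rw [Matrix.inv_def, gramMatrix_det, Ring.inverse_eq_inv', gramMatrix_eq, Matrix.adjugate_fin_two_of]
  simp [div_eq_inv_mul]

lemma gramMatrix_inv_one (z w : Fin n → ℝ) :
    (gramMatrix z w)⁻¹ 1 1 = (∑ i, w i) /
      ((∑ i, w i) * (∑ i, w i * z i ^ 2) - (∑ i, w i * z i) ^ 2) := by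
  rw [Matrix.inv_def, gramMatrix_det, Ring.inverse_eq_inv', gramMatrix_eq, Matrix.adjugate_fin_two_of]
  simp [div_eq_inv_mul]

lemma gramMatrix_mulVec (z w : Fin n → ℝ) (v : Fin 2 → ℝ) :
    (gramMatrix z w).mulVec v = ∑ i, (w i * (regressor (z i) ⬝ᵥ v)) • regressor (z i) := by
  rw [gramMatrix, Matrix.sum_mulVec]
  refine Finset.sum_congr rfl fun i _ => ?_
  ext c
  simp [Matrix.smul_mulVec, Matrix.vecMulVec_mulVec, mul_comm]
  ring

/-- The coefficient of the `i`-th response in the `j`-th entry of the least-squares estimator. -/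
noncomputable def lsCoeff (z w : Fin n → ℝ) (j : Fin 2) (i : Fin n) : ℝ :=
  w i * (gramMatrix z w)⁻¹.mulVec (regressor (z i)) j

lemma lsEstimator_eq_sum (z w y : Fin n → ℝ) (j : Fin 2) :
    lsEstimator z w y j = ∑ i, lsCoeff z w j i * y i := by
  rw [lsEstimator, Matrix.mulVec_sum, Finset.sum_apply]
  refine Finset.sum_congr rfl fun i _ => ?_
  rw [Matrix.mulVec_smul, lsCoeff, Pi.smul_apply, smul_eq_mul]
  ring

/-- This is G⁻¹ (G v) = v read in one coordinate. It gives unbiasedness, and with suitable v the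
variance formulas. -/
lemma sum_lsCoeff_mul_regressor {z w : Fin n → ℝ} (h : IsUnit (gramMatrix z w)) (j : Fin 2)
    (v : Fin 2 → ℝ) : ∑ i, lsCoeff z w j i * (regressor (z i) ⬝ᵥ v) = v j := by
  rw [← lsEstimator_eq_sum, lsEstimator, ← gramMatrix_mulVec, Matrix.mulVec_mulVec,
    Matrix.nonsing_inv_mul _ ((Matrix.isUnit_iff_isUnit_det _).1 h), Matrix.one_mulVec]

lemma lsEstimator_response (z w u : Fin n → ℝ) (b : Fin 2 → ℝ) (j : Fin 2) :
    lsEstimator z w (response b z u) j =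
      ∑ i, lsCoeff z w j i * (regressor (z i) ⬝ᵥ b) + ∑ i, lsCoeff z w j i * u i := by
  rw [lsEstimator_eq_sum, ← Finset.sum_add_distrib]
  refine Finset.sum_congr rfl fun i _ => ?_
  simp only [response, regressor, dotProduct, Fin.sum_univ_two, Matrix.cons_val_zero,
    Matrix.cons_val_one]
  ring

/-- Take v to be row j of G⁻¹ in the preceding identity; idempotent weights turn its left side into
a sum of squares. In the singular case the inverse is 0 by convention and both sides vanish. -/
lemma sum_lsCoeff_sq (z w : Fin n → ℝ) (hw : ∀ i, w i ^ 2 = w i) (j : Fin 2) :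
    ∑ i, lsCoeff z w j i ^ 2 = (gramMatrix z w)⁻¹ j j := by
  by_cases h : IsUnit (gramMatrix z w)
  · rw [← sum_lsCoeff_mul_regressor h j ((gramMatrix z w)⁻¹ j)]
    refine Finset.sum_congr rfl fun i _ => ?_
    rw [lsCoeff, dotProduct_comm]
    change (w i * ((gramMatrix z w)⁻¹ j ⬝ᵥ regressor (z i))) ^ 2 = _ * _ * _
    rw [mul_pow, hw]; simp only [Matrix.mulVec]; ring
  · have : (gramMatrix z w)⁻¹ = 0 := by
      rw [Matrix.isUnit_iff_isUnit_det] at h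
      exact Matrix.nonsing_inv_apply_not_isUnit _ h
    simp [lsCoeff, this]

/-- A quadratic lower bound for the variance of a least-squares estimator with weights
`w i ∈ {0} ∪ [1, ∞)`. -/
lemma two_mul_sub_le_sum_lsCoeff_sq {z w : Fin n → ℝ} (h : IsUnit (gramMatrix z w))
    (hw0 : ∀ i, 0 ≤ w i) (hw : ∀ i, w i ≤ w i ^ 2) (j : Fin 2) (v : Fin 2 → ℝ) :
    2 * v j - ∑ i, w i * (regressor (z i) ⬝ᵥ v) ^ 2 ≤ ∑ i, lsCoeff z w j i ^ 2 := by
  rw [← sum_lsCoeff_mul_regressor h j v, Finset.mul_sum, ← Finset.sum_sub_distrib]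
  refine Finset.sum_le_sum fun i _ => ?_
  rw [lsCoeff]
  set a := (gramMatrix z w)⁻¹.mulVec (regressor (z i)) j
  set c := regressor (z i) ⬝ᵥ v
  -- Termwise, w² a² ≥ w a² ≥ 2 w a c - w c².
  nlinarith [mul_nonneg (hw0 i) (sq_nonneg (a - c)),
    mul_le_mul_of_nonneg_right (hw i) (sq_nonneg a)]

lemma sum_mul_regressor_sq (z w : Fin n → ℝ) (v : Fin 2 → ℝ) :
    ∑ i, w i * (regressor (z i) ⬝ᵥ v) ^ 2 = v ⬝ᵥ (gramMatrix z w).mulVec v := by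
  rw [gramMatrix_mulVec, dotProduct_sum]
  refine Finset.sum_congr rfl fun i _ => ?_
  rw [dotProduct_smul, dotProduct_comm v, smul_eq_mul]; ring

end Algebra

/-! ### Deterministic inequalities for sums -/

/-- The partial sums have opposite signs, so the cross term in the square is nonpositive.
Cauchy–Schwarz on each part then costs only m, not the total number of terms. -/
lemma sq_sum_le_of_sign {ι : Type*} [DecidableEq ι] {L U : Finset ι} (hLU : Disjoint L U)
    {z : ι → ℝ} (hL : ∀ i ∈ L, z i ≤ 0) (hU : ∀ i ∈ U, 0 ≤ z i) {m : ℝ} (hLm : (L.card : ℝ) ≤ m)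
    (hUm : (U.card : ℝ) ≤ m) :
    (∑ i ∈ L ∪ U, z i) ^ 2 ≤ m * ∑ i ∈ L ∪ U, z i ^ 2 := by
  rw [Finset.sum_union hLU, Finset.sum_union hLU]
  have h1 : ∑ i ∈ L, z i ≤ 0 := Finset.sum_nonpos hL
  have h2 : 0 ≤ ∑ i ∈ U, z i := Finset.sum_nonneg hU
  have h3 : (∑ i ∈ L, z i) ^ 2 ≤ m * ∑ i ∈ L, z i ^ 2 :=
    sq_sum_le_card_mul_sum_sq.trans
      (mul_le_mul_of_nonneg_right hLm (Finset.sum_nonneg fun i _ => sq_nonneg _))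
  have h4 : (∑ i ∈ U, z i) ^ 2 ≤ m * ∑ i ∈ U, z i ^ 2 :=
    sq_sum_le_card_mul_sum_sq.trans
      (mul_le_mul_of_nonneg_right hUm (Finset.sum_nonneg fun i _ => sq_nonneg _))
  nlinarith [mul_nonneg (neg_nonneg.2 h1) h2]

lemma rpow_sum_le_sum_rpow {ι : Type*} (s : Finset ι) (x : ι → ℝ) (hx : ∀ i ∈ s, 0 ≤ x i) {q : ℝ}
    (hq : 0 < q) (hq1 : q ≤ 1) : (∑ i ∈ s, x i) ^ q ≤ ∑ i ∈ s, x i ^ q := by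
  classical
  induction s using Finset.induction_on with
  | empty => simp [hq.ne']
  | insert a s ha ih =>
    rw [Finset.sum_insert ha, Finset.sum_insert ha]
    have h1 := ih fun i hi => hx i (Finset.mem_insert_of_mem hi)
    have h2 := Real.rpow_add_le_add_rpow (hx a (Finset.mem_insert_self a s))
      (Finset.sum_nonneg fun i hi => hx i (Finset.mem_insert_of_mem hi)) hq.le hq1
    linarith

/-! ### Conditional variances given the covariates -/

section ErrorLaw

/-- A law of error vectors with mean `0` and covariance matrix `σ ^ 2 • 1`. -/
structure IsHomoscedastic {n : ℕ} (P : Measure (Fin n → ℝ)) (σ : ℝ) : Prop where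
  memLp : ∀ i, MemLp (fun u => u i) 2 P
  mean : ∀ i, ∫ u, u i ∂P = 0
  cov : ∀ i j, ∫ u, u i * u j ∂P = if i = j then σ ^ 2 else 0

namespace IsHomoscedastic

variable {n : ℕ} {P : Measure (Fin n → ℝ)} {σ : ℝ}

lemma memLp_sum (h : IsHomoscedastic P σ) (a : Fin n → ℝ) :
    MemLp (fun u => ∑ i, a i * u i) 2 P :=
  memLp_finsetSum _ fun i _ => (h.memLp i).const_mul (a i)

lemma integral_sum [IsProbabilityMeasure P] (h : IsHomoscedastic P σ) (a : Fin n → ℝ) :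
    ∫ u, ∑ i, a i * u i ∂P = 0 := by
  rw [integral_finsetSum _ fun i _ => ((h.memLp i).integrable one_le_two).const_mul (a i)]
  simp [integral_const_mul, h.mean]

lemma integral_sum_sq (h : IsHomoscedastic P σ) (a : Fin n → ℝ) :
    ∫ u, (∑ i, a i * u i) ^ 2 ∂P = σ ^ 2 * ∑ i, a i ^ 2 := by
  have hint : ∀ i j, Integrable (fun u : Fin n → ℝ => a i * u i * (a j * u j)) P := fun i j =>
    ((h.memLp i).const_mul (a i)).integrable_mul ((h.memLp j).const_mul (a j))
  simp_rw [pow_two (∑ i, _ * _), Finset.sum_mul_sum]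
  rw [integral_finsetSum _ fun i _ => integrable_finsetSum _ fun j _ => hint i j]
  rw [Finset.mul_sum]
  refine Finset.sum_congr rfl fun i _ => ?_
  rw [integral_finsetSum _ fun j _ => hint i j]
  simp_rw [mul_mul_mul_comm (a i), integral_const_mul, h.cov]
  simp
  ring

lemma variance_const_add_sum [IsProbabilityMeasure P] (h : IsHomoscedastic P σ) (c : ℝ) (a : Fin n → ℝ) :
    variance (fun u => c + ∑ i, a i * u i) P = σ ^ 2 * ∑ i, a i ^ 2 := by
  rw [variance_const_add (h.memLp_sum a).aestronglyMeasurable,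
    variance_of_integral_eq_zero (h.memLp_sum a).aemeasurable (h.integral_sum a),
    h.integral_sum_sq]

lemma variance_lsEstimator [IsProbabilityMeasure P] (h : IsHomoscedastic P σ) (b : Fin 2 → ℝ)
    (z w : Fin n → ℝ) (j : Fin 2) :
    variance (fun u => lsEstimator z w (response b z u) j) P =
      σ ^ 2 * ∑ i, lsCoeff z w j i ^ 2 := by
  simp_rw [lsEstimator_response]
  exact h.variance_const_add_sum _ _

end IsHomoscedastic

variable {Ω : Type*} [MeasurableSpace Ω] {μ : Measure Ω} [IsProbabilityMeasure μ]

instance errorLaw.instIsProbabilityMeasure (z e : ℕ → Ω → ℝ) (n : ℕ) (ω : Ω) :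
    IsProbabilityMeasure (errorLaw μ z e n ω) := by
  unfold errorLaw; infer_instance

/-- Conditional expectations given the covariates are integrals against the conditional
distribution, so the moment hypotheses pass to almost every fibre. Countably many n and finitely
many indices leave a single null set. -/
lemma ae_isHomoscedastic_errorLaw {σ : ℝ} {z e : ℕ → Ω → ℝ} (hz : ∀ i, Measurable (z i))
    (he : IsRegressionError μ σ z e) :
    ∀ᵐ ω ∂μ, ∀ n, IsHomoscedastic (errorLaw μ z e n ω) σ := by
  obtain ⟨hem, heL, hc⟩ := he
  rw [ae_all_iff]
  intro n
  have hZ : Measurable (firstTerms z n) := measurable_pi_lambda _ fun i => hz i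
  have hE : Measurable (firstTerms e n) := measurable_pi_lambda _ fun i => hem i
  have h1 : ∀ i : Fin n, ∀ᵐ ω ∂μ, ∫ u, u i ∂(errorLaw μ z e n ω) = 0 := by
    intro i
    have h := condExp_ae_eq_integral_condDistrib (μ := μ) hZ hE.aemeasurable
      (f := fun u : Fin n → ℝ => u i) (measurable_pi_apply i).stronglyMeasurable
      ((heL i).integrable one_le_two)
    filter_upwards [h, (hc n i i i.2 i.2).1] with ω h1 h2
    exact h1.symm.trans h2
  have hint : ∀ i j : Fin n, Integrable (fun ω => e i ω * e j ω) μ := fun i j =>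
    (heL i).integrable_mul (heL j)
  have h2 : ∀ i j : Fin n, ∀ᵐ ω ∂μ,
      ∫ u, u i * u j ∂(errorLaw μ z e n ω) = if i = j then σ ^ 2 else 0 := by
    intro i j
    have h := condExp_ae_eq_integral_condDistrib (μ := μ) hZ hE.aemeasurable
      (f := fun u : Fin n → ℝ => u i * u j)
      ((measurable_pi_apply i).mul (measurable_pi_apply j)).stronglyMeasurable (hint i j)
    filter_upwards [h, (hc n i j i.2 j.2).2] with ω h1 h2
    refine h1.symm.trans (h2.trans ?_)
    simp [Fin.ext_iff]
  have h3 : ∀ i : Fin n, ∀ᵐ ω ∂μ, MemLp (fun u => u i) 2 (errorLaw μ z e n ω) := by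
    intro i
    have hm : StronglyMeasurable fun u : Fin n → ℝ => u i * u i :=
      ((measurable_pi_apply i).mul (measurable_pi_apply i)).stronglyMeasurable
    have h := Integrable.condDistrib_ae (μ := μ) (X := firstTerms z n) (Y := firstTerms e n)
      hZ.aemeasurable hE.aemeasurable (f := fun p => p.2 i * p.2 i)
      ((integrable_map_measure (by fun_prop) (by fun_prop)).2 (hint i i))
    filter_upwards [h] with ω h
    rw [memLp_two_iff_integrable_sq (measurable_pi_apply i).aestronglyMeasurable]
    simp_rw [pow_two]
    exact h
  rw [← ae_all_iff] at h1 h3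
  simp_rw [← ae_all_iff] at h2
  filter_upwards [h1, h2, h3] with ω h1 h2 h3 using ⟨h3, h1, h2⟩

/-- The null set is fixed before `b`, `n`, `w`, `j`, and `w` is only evaluated at the observed
covariates; hence a selection rule need not be measurable. -/
lemma ae_lsCondVar_eq {σ : ℝ} {z e : ℕ → Ω → ℝ} (hz : ∀ i, Measurable (z i))
    (he : IsRegressionError μ σ z e) :
    ∀ᵐ ω ∂μ, ∀ (b : Fin 2 → ℝ) (n : ℕ) (w : (Fin n → ℝ) → Fin n → ℝ) (j : Fin 2),
      (∀ Z i, w Z i ^ 2 = w Z i) → lsCondVar μ z e b n w j ω =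
        σ ^ 2 * (gramMatrix (firstTerms z n ω) (w (firstTerms z n ω)))⁻¹ j j := by
  filter_upwards [ae_isHomoscedastic_errorLaw hz he] with ω h b n w j hw
  rw [lsCondVar, (h n).variance_lsEstimator, sum_lsCoeff_sq _ _ (hw _)]

end ErrorLaw

/-! ### Uniform subsampling -/

section Uniform

variable {n k : ℕ}

lemma drawCounts_nonneg (d : Fin k → Fin n) (i : Fin n) : 0 ≤ drawCounts d i :=
  Nat.cast_nonneg _

lemma drawCounts_le_sq (d : Fin k → Fin n) (i : Fin n) : drawCounts d i ≤ drawCounts d i ^ 2 := by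
  unfold drawCounts
  exact_mod_cast Nat.le_self_pow two_ne_zero _

lemma sum_drawCounts (d : Fin k → Fin n) : ∑ i, drawCounts d i = k := by
  unfold drawCounts
  rw [← Nat.cast_sum, ← Finset.card_eq_sum_card_fiberwise fun _ _ => Finset.mem_coe.2 (Finset.mem_univ _)]
  simp

lemma drawCounts_pos (d : Fin k → Fin n) (l : Fin k) : 0 < drawCounts d (d l) := by
  unfold drawCounts
  exact_mod_cast Finset.card_pos.2 ⟨l, by simp⟩

lemma drawCounts_perm_comp (τ : Equiv.Perm (Fin n)) (d : Fin k → Fin n) (i : Fin n) :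
    drawCounts (τ ∘ d) (τ i) = drawCounts d i := by
  simp [drawCounts]

lemma isProbabilityMeasure_uniformDraws (repl : Bool) (hkn : k ≤ n) :
    IsProbabilityMeasure (uniformDraws repl n k) :=
  isProbabilityMeasure_uniformOn (Set.toFinite _)
    ⟨Fin.castLE hkn, Or.inr (Fin.castLE_injective hkn)⟩

/-- Relabelling the data points preserves injectivity, hence the set of admissible draws in both
schemes. -/
lemma uniformDraws_real_singleton_perm_comp (repl : Bool) (τ : Equiv.Perm (Fin n))
    (d : Fin k → Fin n) :
    (uniformDraws repl n k).real {τ ∘ d} = (uniformDraws repl n k).real {d} := by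
  have hS : (τ ∘ d ∈ {d : Fin k → Fin n | repl = true ∨ Function.Injective d}) ↔
      d ∈ {d : Fin k → Fin n | repl = true ∨ Function.Injective d} := by
    simp [τ.injective.of_comp_iff]
  unfold uniformDraws uniformOn
  rw [Measure.real, Measure.real, cond_apply (Set.toFinite _).measurableSet,
    cond_apply (Set.toFinite _).measurableSet]
  congr 2
  by_cases h : d ∈ {d : Fin k → Fin n | repl = true ∨ Function.Injective d}
  · rw [Set.inter_eq_right.2 (Set.singleton_subset_iff.2 h),
      Set.inter_eq_right.2 (Set.singleton_subset_iff.2 (hS.2 h)), Measure.count_singleton,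
      Measure.count_singleton]
  · rw [Set.inter_singleton_eq_empty.2 h, Set.inter_singleton_eq_empty.2 (mt hS.1 h)]

/-- By exchangeability all expected counts coincide, and they add up to `k`; the law of a count is
never computed. -/
lemma integral_drawCounts (repl : Bool) (hkn : k ≤ n) (i : Fin n) :
    ∫ d, drawCounts d i ∂(uniformDraws repl n k) = k / n := by
  have := isProbabilityMeasure_uniformDraws repl hkn
  have hperm : ∀ τ : Equiv.Perm (Fin n), ∀ i,
      ∫ d, drawCounts d (τ i) ∂(uniformDraws repl n k) =
        ∫ d, drawCounts d i ∂(uniformDraws repl n k) := by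
    intro τ i
    rw [integral_fintype .of_finite, integral_fintype .of_finite]
    refine (Fintype.sum_equiv (Equiv.arrowCongr (Equiv.refl (Fin k)) τ) _ _ fun d => ?_).symm
    have h : (Equiv.arrowCongr (Equiv.refl (Fin k)) τ) d = τ ∘ d := rfl
    rw [h, uniformDraws_real_singleton_perm_comp, drawCounts_perm_comp]
  have hall : ∀ m, ∫ d, drawCounts d m ∂(uniformDraws repl n k) =
      ∫ d, drawCounts d i ∂(uniformDraws repl n k) := fun m => by
    simpa using hperm (Equiv.swap i m) i
  have hsum : ∑ m : Fin n, ∫ d, drawCounts d m ∂(uniformDraws repl n k) = k := by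
    rw [← integral_finsetSum _ fun _ _ => .of_finite]
    simp [sum_drawCounts]
  simp_rw [hall] at hsum
  have hn : (n : ℝ) ≠ 0 := by exact_mod_cast (Nat.pos_of_ne_zero (by rintro rfl; exact i.elim0)).ne'
  rw [eq_div_iff hn, ← hsum]
  simp [mul_comm]

/-- The determinant is the total weight times the weighted sum of squared deviations from the
weighted mean `m`, and two distinct values cannot both equal `m`. -/
lemma gramMatrix_det_pos {z w : Fin n → ℝ} (hw : ∀ i, 0 ≤ w i) {i l : Fin n} (hi : 0 < w i)
    (hl : 0 < w l) (hz : z i ≠ z l) : 0 < (gramMatrix z w).det := by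
  rw [gramMatrix_det]
  have h0 : 0 < ∑ i, w i := Finset.sum_pos' (fun i _ => hw i) ⟨i, Finset.mem_univ _, hi⟩
  set m := (∑ i, w i * z i) / ∑ i, w i with hm
  have hpos : 0 < ∑ i, w i * (z i - m) ^ 2 := by
    refine Finset.sum_pos' (fun i _ => mul_nonneg (hw i) (sq_nonneg _)) ?_
    by_cases him : z i = m
    · exact ⟨l, Finset.mem_univ _, mul_pos hl (by
        have : z l - m ≠ 0 := sub_ne_zero.2 fun h => hz (him.trans h.symm)
        positivity)⟩
    · exact ⟨i, Finset.mem_univ _, mul_pos hi (by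
        have : z i - m ≠ 0 := sub_ne_zero.2 him
        positivity)⟩
  have hexp : ∑ i, w i * (z i - m) ^ 2 =
      ∑ i, w i * z i ^ 2 - 2 * m * ∑ i, w i * z i + m ^ 2 * ∑ i, w i := by
    rw [Finset.mul_sum, Finset.mul_sum, ← Finset.sum_sub_distrib, ← Finset.sum_add_distrib]
    exact Finset.sum_congr rfl fun i _ => by ring
  have hmS : m * ∑ i, w i = ∑ i, w i * z i := div_mul_cancel₀ _ h0.ne'
  have := mul_pos h0 hpos
  rw [hexp] at this
  rw [← hmS] at this ⊢
  linarith [this]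

lemma half_le_uniformDraws_ne (repl : Bool) (hkn : k ≤ n) {l m : Fin k} (hlm : l ≠ m) :
    1 / 2 ≤ (uniformDraws repl n k).real {d | d l ≠ d m} := by
  have := isProbabilityMeasure_uniformDraws repl hkn
  cases repl with
  | false =>
    have : (uniformDraws false n k) {d | d l ≠ d m} = 1 := by
      refine uniformOn_eq_one_of (Set.toFinite _)
        ⟨Fin.castLE hkn, Or.inr (Fin.castLE_injective hkn)⟩ fun d hd => ?_
      simp only [Bool.false_eq_true, false_or, Set.mem_ofPred_eq] at hd
      exact hd.ne hlm
    rw [Measure.real, this]; norm_num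
  | true =>
    have hS : {d : Fin k → Fin n | true = true ∨ Function.Injective d} = Set.univ := by
      simp
    have hle : uniformDraws true n k {d | d l ≠ d m}ᶜ ≤ uniformDraws true n k {d | d l ≠ d m} := by
      unfold uniformDraws
      rw [hS, uniformOn_univ, uniformOn_univ, Measure.count_apply (Set.toFinite _).measurableSet,
        Measure.count_apply (Set.toFinite _).measurableSet]
      refine ENNReal.div_le_div_right (ENat.toENNReal_le.2 ?_) _
      have hn : 2 ≤ n := by
        have h1 := l.2
        have h2 := m.2
        have h3 := Fin.val_ne_of_ne hlm
        omega
      obtain ⟨p, rfl⟩ := Nat.exists_eq_add_of_le' hn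
      -- Shifting draw `l` cyclically by one maps draws with a coincidence injectively to draws
      -- without one; `n ≥ 2` guarantees that the shift moves every point.
      refine Set.encard_le_encard_of_injOn 
        (f := fun d : Fin k → Fin (p + 2) => Function.update d l (d l + 1)) ?_ ?_
      · intro d hd
        have hd' : d l = d m := by simpa using hd
        simp [Function.update_of_ne hlm.symm, ← hd']
      · intro d _ d' _ hdd
        funext a
        have ha := congrFun hdd a
        by_cases h : a = l
        · subst h
          simpa using ha
        · simpa [Function.update_of_ne h] using ha
    have hadd := probReal_add_probReal_compl (μ := uniformDraws true n k)
      (Set.toFinite {d : Fin k → Fin n | d l ≠ d m}).measurableSet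
    have : (uniformDraws true n k).real {d | d l ≠ d m}ᶜ ≤
        (uniformDraws true n k).real {d | d l ≠ d m} :=
      ENNReal.toReal_mono (measure_ne_top _ _) hle
    linarith

lemma half_le_fullRankDraws (repl : Bool) (hk : 2 ≤ k) (hkn : k ≤ n) {z : Fin n → ℝ}
    (hz : Function.Injective z) : 1 / 2 ≤ (uniformDraws repl n k).real (fullRankDraws k z) := by
  have := isProbabilityMeasure_uniformDraws repl hkn
  refine (half_le_uniformDraws_ne repl hkn
    (l := ⟨0, by omega⟩) (m := ⟨1, by omega⟩) (by simp)).trans (measureReal_mono fun d hd => ?_)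
  rw [fullRankDraws, Set.mem_ofPred_eq, Matrix.isUnit_iff_isUnit_det]
  exact (gramMatrix_det_pos (drawCounts_nonneg d) (drawCounts_pos d _) (drawCounts_pos d _)
    (hz.ne hd)).ne'.isUnit

/-- There are finitely many draws, so the coefficients are bounded and multiply square-integrable
errors. -/
lemma IsHomoscedastic.memLp_lsEstimator_drawCounts {P : Measure (Fin n → ℝ)} {σ : ℝ}
    (h : IsHomoscedastic P σ) [IsProbabilityMeasure P] (Q : Measure (Fin k → Fin n))
    [IsFiniteMeasure Q] (b : Fin 2 → ℝ) (z : Fin n → ℝ) (j : Fin 2) :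
    MemLp (fun p : (Fin n → ℝ) × (Fin k → Fin n) =>
      lsEstimator z (drawCounts p.2) (response b z p.1) j) 2 (P.prod Q) := by
  simp_rw [lsEstimator_response]
  have hd : ∀ f : (Fin k → Fin n) → ℝ, MemLp (fun p : (Fin n → ℝ) × (Fin k → Fin n) => f p.2) ⊤
      (P.prod Q) := fun f => (MemLp.of_discrete (f := f) (μ := Q)).comp_snd P
  refine MemLp.add ((hd fun d => ∑ i, lsCoeff z (drawCounts d) j i * (regressor (z i) ⬝ᵥ b)).mono_exponent le_top) ?_
  refine memLp_finsetSum _ fun i _ => ?_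
  exact MemLp.mul (p := ⊤) (q := 2) ((h.memLp i).comp_fst Q) (hd fun d => lsCoeff z (drawCounts d) j i)

/-- The covariance lower bound for uniform subsampling, for fixed covariates. -/
lemma IsHomoscedastic.le_variance_lsEstimator_drawCounts {P : Measure (Fin n → ℝ)} {σ : ℝ}
    (h : IsHomoscedastic P σ) [IsProbabilityMeasure P] (repl : Bool) (b : Fin 2 → ℝ)
    (z : Fin n → ℝ) (j : Fin 2) (hk : 2 ≤ k) (hkn : k ≤ n) :
    σ ^ 2 * (uniformDraws repl n k).real (fullRankDraws k z) / k *
        (gramMatrix z (fun _ => 1 / (n : ℝ)))⁻¹ j j ≤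
      variance (fun p : (Fin n → ℝ) × (Fin k → Fin n) =>
        lsEstimator z (drawCounts p.2) (response b z p.1) j)
        (P.prod (ProbabilityTheory.cond (uniformDraws repl n k) (fullRankDraws k z))) := by
  have := isProbabilityMeasure_uniformDraws repl hkn
  set U := uniformDraws repl n k
  set D := fullRankDraws k z
  set Q := ProbabilityTheory.cond U D with hQ
  set G := gramMatrix z (fun _ => 1 / (n : ℝ)) with hG
  -- In the degenerate cases, full rank of probability zero or `G` singular, the lower bound is 0.
  by_cases hp : U D = 0
  · simp [Measure.real, hp, variance_nonneg]
  by_cases hGu : IsUnit G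
  swap
  · have : G⁻¹ = 0 := by
      rw [Matrix.isUnit_iff_isUnit_det] at hGu
      exact Matrix.nonsing_inv_apply_not_isUnit _ hGu
    simp [this, variance_nonneg]
  have hQp : IsProbabilityMeasure Q := cond_isProbabilityMeasure hp
  set p := U.real D with hpdef
  have hp0 : 0 < p := ENNReal.toReal_pos hp (measure_ne_top _ _)
  have hk0 : (0 : ℝ) < k := by exact_mod_cast (by omega : 0 < k)
  have hD : ∀ᵐ d ∂Q, d ∈ D := ae_cond_mem (Set.toFinite D).measurableSet
  have hmem := h.memLp_lsEstimator_drawCounts Q b z j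
  have hest : ∀ d ∈ D, ∀ u, lsEstimator z (drawCounts d) (response b z u) j =
      b j + ∑ i, lsCoeff z (drawCounts d) j i * u i := fun d hd u => by
    rw [lsEstimator_response, sum_lsCoeff_mul_regressor hd]
  have hmean : ∫ q, lsEstimator z (drawCounts q.2) (response b z q.1) j ∂(P.prod Q) = b j := by
    rw [integral_prod_symm _ (hmem.integrable one_le_two)]
    have : ∀ᵐ d ∂Q, ∫ u, lsEstimator z (drawCounts d) (response b z u) j ∂P = b j := by
      filter_upwards [hD] with d hd
      simp_rw [hest d hd]
      rw [integral_add (integrable_const _) ((h.memLp_sum _).integrable one_le_two),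
        h.integral_sum]
      simp
    rw [integral_congr_ae this]
    simp
  have hint : Integrable (fun q : (Fin n → ℝ) × (Fin k → Fin n) =>
      (lsEstimator z (drawCounts q.2) (response b z q.1) j - b j) ^ 2) (P.prod Q) :=
    (hmem.sub (memLp_const (b j))).integrable_sq
  rw [variance_eq_integral hmem.aemeasurable, hmean, integral_prod_symm _ hint]
  -- This `v` maximizes 2 v_j - (k / p) vᵀ G v, the averaged lower bound for the sum of squared
  -- coefficients; the maximum is v_j itself.
  set v : Fin 2 → ℝ := (p / k) • G⁻¹.mulVec (Pi.single j 1) with hv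
  have hGv : G.mulVec v = (p / k) • Pi.single j 1 := by
    rw [hv, Matrix.mulVec_smul, Matrix.mulVec_mulVec,
      Matrix.mul_nonsing_inv _ ((Matrix.isUnit_iff_isUnit_det _).1 hGu), Matrix.one_mulVec]
  have hvj : v j = p / k * G⁻¹ j j := by
    simp [hv]
  have hquad : ∫ d, ∑ i, drawCounts d i * (regressor (z i) ⬝ᵥ v) ^ 2 ∂U =
      k * (p / k) * v j := by
    rw [integral_finsetSum _ fun _ _ => .of_finite]
    simp_rw [integral_mul_const]
    have : ∑ i, (1 / (n : ℝ)) * (regressor (z i) ⬝ᵥ v) ^ 2 = p / k * v j := by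
      rw [sum_mul_regressor_sq z (fun _ => 1 / (n : ℝ)), ← hG, hGv]
      simp
    rw [mul_assoc, ← this, Finset.mul_sum]
    refine Finset.sum_congr rfl fun i _ => ?_
    rw [integral_drawCounts repl hkn]
    ring
  -- Conditioning on full rank costs at most a factor 1 / p, because the integrand is nonnegative on
  -- the discarded draws. This is where the probability enters the bound.
  have hquadQ : ∫ d, ∑ i, drawCounts d i * (regressor (z i) ⬝ᵥ v) ^ 2 ∂Q ≤ v j := by
    rw [hQ, ProbabilityTheory.cond, integral_smul_measure, ENNReal.toReal_inv]
    have h1 : ∫ d in D, ∑ i, drawCounts d i * (regressor (z i) ⬝ᵥ v) ^ 2 ∂U ≤ p * v j := by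
      refine (setIntegral_le_integral .of_finite (ae_of_all _ fun d =>
        Finset.sum_nonneg fun i _ => mul_nonneg (drawCounts_nonneg d i) (sq_nonneg _))).trans ?_
      rw [hquad]
      exact le_of_eq (by field_simp)
    calc _ ≤ p⁻¹ * (p * v j) := mul_le_mul_of_nonneg_left h1 (inv_nonneg.2 hp0.le)
      _ = v j := by field_simp
  have hlow : ∫ d, σ ^ 2 * (2 * v j - ∑ i, drawCounts d i * (regressor (z i) ⬝ᵥ v) ^ 2) ∂Q ≤
      ∫ d, ∫ u, (lsEstimator z (drawCounts d) (response b z u) j - b j) ^ 2 ∂P ∂Q := by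
    refine integral_mono_ae .of_finite .of_finite ?_
    filter_upwards [hD] with d hd
    simp_rw [hest d hd, add_sub_cancel_left]
    rw [h.integral_sum_sq]
    exact mul_le_mul_of_nonneg_left (two_mul_sub_le_sum_lsCoeff_sq hd (drawCounts_nonneg d)
      (drawCounts_le_sq d) j v) (sq_nonneg σ)
  refine le_trans ?_ hlow
  rw [integral_const_mul, integral_sub (integrable_const _) .of_finite]
  have : σ ^ 2 * p / k * G⁻¹ j j = σ ^ 2 * v j := by rw [hvj]; ring
  rw [this]
  refine mul_le_mul_of_nonneg_left ?_ (sq_nonneg σ)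
  simp only [integral_const, probReal_univ, smul_eq_mul, one_mul]
  linarith

lemma ae_uniLowerBound_le {Ω : Type*} [MeasurableSpace Ω] {μ : Measure Ω} [IsProbabilityMeasure μ]
    {σ : ℝ} {z e : ℕ → Ω → ℝ} (hz : ∀ i, Measurable (z i)) (he : IsRegressionError μ σ z e)
    (b : Fin 2 → ℝ) (repl : Bool) (j : Fin 2) (hk : 2 ≤ k) (hkn : k ≤ n) :
    ∀ᵐ ω ∂μ, uniLowerBound σ z repl j k n ω ≤ uniCondVar μ z e b repl j k n ω := by
  filter_upwards [ae_isHomoscedastic_errorLaw hz he] with ω h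
  exact (h n).le_variance_lsEstimator_drawCounts repl b _ j hk hkn

end Uniform

/-! ### Student's `t` distribution: tails and moments -/

section StudentT

variable {ν : ℝ}

lemma studentTDensity_const_pos (hν : 0 < ν) :
    0 < Real.Gamma ((ν + 1) / 2) / (Real.sqrt (ν * Real.pi) * Real.Gamma (ν / 2)) :=
  div_pos (Real.Gamma_pos_of_pos (by positivity))
    (mul_pos (Real.sqrt_pos.2 (mul_pos hν Real.pi_pos)) (Real.Gamma_pos_of_pos (by positivity)))

lemma studentTDensity_pos (hν : 0 < ν) (x : ℝ) : 0 < studentTDensity ν x :=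
  mul_pos (studentTDensity_const_pos hν) (Real.rpow_pos_of_pos (by positivity) _)

lemma measurable_studentTDensity : Measurable (studentTDensity ν) := by
  unfold studentTDensity; fun_prop

/-- Since 1 + x² / ν ≥ min(1, 1/ν) (1 + x²), the negative exponent yields the bound. It serves both
the tail estimate and the moments. -/
lemma exists_studentTDensity_le (hν : 0 < ν) :
    ∃ A : ℝ, 0 < A ∧ ∀ x, studentTDensity ν x ≤ A * (1 + x ^ 2) ^ (-((ν + 1) / 2)) := by
  have hm : 0 < min 1 (1 / ν) := lt_min one_pos (by positivity)
  refine ⟨_, mul_pos (studentTDensity_const_pos hν)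
    (Real.rpow_pos_of_pos hm (-((ν + 1) / 2))), fun x => ?_⟩
  rw [studentTDensity, mul_assoc, ← Real.mul_rpow hm.le (by positivity)]
  refine mul_le_mul_of_nonneg_left ?_ (studentTDensity_const_pos hν).le
  refine Real.rpow_le_rpow_of_nonpos (by positivity) ?_ (by linarith)
  have h := mul_le_mul_of_nonneg_right (min_le_right 1 (1 / ν)) (sq_nonneg x)
  have hx : x ^ 2 / ν = 1 / ν * x ^ 2 := by ring
  rw [hx, mul_add, mul_one]
  exact add_le_add (min_le_left _ _) h

lemma exists_le_studentTDensity (hν : 0 < ν) :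
    ∃ B : ℝ, 0 < B ∧ ∀ x, 1 ≤ x → B * x ^ (-(ν + 1)) ≤ studentTDensity ν x := by
  have hm : 0 < 1 + 1 / ν := by positivity
  refine ⟨_, mul_pos (studentTDensity_const_pos hν)
    (Real.rpow_pos_of_pos hm (-((ν + 1) / 2))), fun x hx => ?_⟩
  have hx2 : x ^ (-(ν + 1)) = (x ^ 2) ^ (-((ν + 1) / 2)) := by
    rw [← Real.rpow_natCast, ← Real.rpow_mul (by linarith)]
    congr 1; push_cast; ring
  rw [studentTDensity, mul_assoc, hx2, ← Real.mul_rpow hm.le (by positivity)]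
  refine mul_le_mul_of_nonneg_left ?_ (studentTDensity_const_pos hν).le
  refine Real.rpow_le_rpow_of_nonpos (by positivity) ?_ (by linarith)
  have : (1 + 1 / ν) * x ^ 2 = x ^ 2 + x ^ 2 / ν := by ring
  rw [this]
  nlinarith

lemma studentT_absolutelyContinuous : studentT ν ≪ volume :=
  withDensity_absolutelyContinuous _ _

lemma absolutelyContinuous_studentT (hν : 0 < ν) : volume ≪ studentT ν :=
  withDensity_absolutelyContinuous' measurable_studentTDensity.ennreal_ofReal.aemeasurable
    (ae_of_all _ fun x => (ENNReal.ofReal_pos.2 (studentTDensity_pos hν x)).ne')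

lemma studentT_singleton (x : ℝ) : studentT ν {x} = 0 :=
  studentT_absolutelyContinuous Real.volume_singleton

lemma setLIntegral_Iio_neg_of_even {g : ℝ → ENNReal} (hg : ∀ x, g (-x) = g x) (t : ℝ) :
    ∫⁻ x in Set.Iio (-t), g x = ∫⁻ x in Set.Ioi t, g x := by
  have h := (Measure.measurePreserving_neg (volume : Measure ℝ)).setLIntegral_comp_preimage_emb
    (MeasurableEquiv.neg ℝ).measurableEmbedding g (Set.Ioi t)
  rw [← h]
  simp [hg]

lemma exists_studentT_tail_le (hν : 0 < ν) :
    ∃ A : ℝ, 0 < A ∧ ∀ t, 0 < t →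
      studentT ν {x | ¬ |x| ≤ t} ≤ ENNReal.ofReal (A * t ^ (-ν)) := by
  obtain ⟨A, hA, hbound⟩ := exists_studentTDensity_le hν
  -- Each half-line contributes A / ν, from integrating A x^(-(ν+1)) beyond t.
  refine ⟨2 * (A / ν), by positivity, fun t ht => ?_⟩
  have hset : {x : ℝ | ¬ |x| ≤ t} = Set.Iio (-t) ∪ Set.Ioi t := by
    ext x
    simp only [Set.mem_ofPred_eq, Set.mem_union, Set.mem_Iio, Set.mem_Ioi, not_le, lt_abs]
    constructor
    · rintro (h | h)
      exacts [Or.inr h, Or.inl (by linarith)]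
    · rintro (h | h)
      exacts [Or.inr (by linarith), Or.inl h]
  have heven : ∀ x, ENNReal.ofReal (studentTDensity ν (-x)) = ENNReal.ofReal (studentTDensity ν x) :=
    fun x => by simp [studentTDensity]
  have hright : studentT ν (Set.Ioi t) ≤ ENNReal.ofReal (A / ν * t ^ (-ν)) := by
    rw [studentT, withDensity_apply _ measurableSet_Ioi]
    have hint : IntegrableOn (fun x : ℝ => A * x ^ (-(ν + 1))) (Set.Ioi t) :=
      (integrableOn_Ioi_rpow_of_lt (by linarith) ht).const_mul A
    calc ∫⁻ x in Set.Ioi t, ENNReal.ofReal (studentTDensity ν x)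
        ≤ ∫⁻ x in Set.Ioi t, ENNReal.ofReal (A * x ^ (-(ν + 1))) := by
          refine setLIntegral_mono' measurableSet_Ioi fun x hx => ENNReal.ofReal_le_ofReal ?_
          have hx0 : 0 < x := ht.trans hx
          refine (hbound x).trans (mul_le_mul_of_nonneg_left ?_ hA.le)
          have hx2 : x ^ (-(ν + 1)) = (x ^ 2) ^ (-((ν + 1) / 2)) := by
            rw [← Real.rpow_natCast, ← Real.rpow_mul hx0.le]
            congr 1; push_cast; ring
          rw [hx2]
          exact Real.rpow_le_rpow_of_nonpos (by positivity) (by linarith) (by linarith)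
      _ = ENNReal.ofReal (∫ x in Set.Ioi t, A * x ^ (-(ν + 1))) := by
          rw [ofReal_integral_eq_lintegral_ofReal hint]
          filter_upwards [ae_restrict_mem measurableSet_Ioi] with x hx
          exact mul_nonneg hA.le (Real.rpow_nonneg (ht.trans hx).le _)
      _ = ENNReal.ofReal (A / ν * t ^ (-ν)) := by
          rw [integral_const_mul, integral_Ioi_rpow_of_lt (by linarith) ht]
          congr 1
          rw [show -(ν + 1) + 1 = -ν by ring]
          field_simp
  have hleft : studentT ν (Set.Iio (-t)) = studentT ν (Set.Ioi t) := by
    rw [studentT, withDensity_apply _ measurableSet_Iio, withDensity_apply _ measurableSet_Ioi]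
    exact setLIntegral_Iio_neg_of_even heven t
  rw [hset]
  refine (measure_union_le _ _).trans ?_
  rw [hleft]
  refine (add_le_add hright hright).trans ?_
  rw [← ENNReal.ofReal_add (by positivity) (by positivity)]
  exact ENNReal.ofReal_le_ofReal (by ring_nf; rfl)

/-- The interval [t, 2t] suffices: its length is t, and on it the density is at least the power
bound taken at 2t. -/
lemma exists_le_studentT_tail (hν : 0 < ν) :
    ∃ B : ℝ, 0 < B ∧ ∀ t, 1 ≤ t →
      ENNReal.ofReal (B * t ^ (-ν)) ≤ studentT ν {x | t ≤ |x|} := by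
  obtain ⟨B, hB, hbound⟩ := exists_le_studentTDensity hν
  refine ⟨B * 2 ^ (-(ν + 1)), by positivity, fun t ht => ?_⟩
  have ht0 : 0 < t := by linarith
  calc ENNReal.ofReal (B * 2 ^ (-(ν + 1)) * t ^ (-ν))
      = ENNReal.ofReal (B * (2 * t) ^ (-(ν + 1))) * volume (Set.Icc t (2 * t)) := by
        rw [Real.volume_Icc, ← ENNReal.ofReal_mul (by positivity)]
        congr 1
        rw [Real.mul_rpow zero_le_two ht0.le, show -ν = -(ν + 1) + 1 by ring,
          Real.rpow_add_one ht0.ne']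
        ring
    _ = ∫⁻ _ in Set.Icc t (2 * t), ENNReal.ofReal (B * (2 * t) ^ (-(ν + 1))) := by simp
    _ ≤ ∫⁻ x in Set.Icc t (2 * t), ENNReal.ofReal (studentTDensity ν x) := by
        refine setLIntegral_mono' measurableSet_Icc fun x hx => ENNReal.ofReal_le_ofReal ?_
        refine le_trans (mul_le_mul_of_nonneg_left ?_ hB.le) (hbound x (ht.trans hx.1))
        exact Real.rpow_le_rpow_of_nonpos (ht0.trans_le hx.1) hx.2 (by linarith)
    _ = studentT ν (Set.Icc t (2 * t)) := by rw [studentT, withDensity_apply _ measurableSet_Icc]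
    _ ≤ _ := measure_mono fun x hx => hx.1.trans (le_abs_self x)

/-- Bounding |x|^p by (1 + x²)^(p/2) leaves a density-type function of decay exponent ν + 1 - p > 1.
-/
lemma integrable_abs_rpow_studentT (hν : 0 < ν) {p : ℝ} (hp : 0 ≤ p) (hpν : p < ν) :
    Integrable (fun x : ℝ => |x| ^ p) (studentT ν) := by
  obtain ⟨A, hA, hbound⟩ := exists_studentTDensity_le hν
  rw [studentT, integrable_withDensity_iff measurable_studentTDensity.ennreal_ofReal
    (ae_of_all _ fun x => ENNReal.ofReal_lt_top)]
  have h := (integrable_rpow_neg_one_add_norm_sq (E := ℝ) (μ := volume) (r := ν + 1 - p)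
    (by simp; linarith)).const_mul A
  refine h.mono' ?_ (ae_of_all _ fun x => ?_)
  · exact Measurable.aestronglyMeasurable
      ((by fun_prop : Measurable fun x : ℝ => |x| ^ p).mul
        measurable_studentTDensity.ennreal_ofReal.ennreal_toReal)
  rw [ENNReal.toReal_ofReal (studentTDensity_pos hν x).le, Real.norm_eq_abs, Real.norm_eq_abs,
    sq_abs, abs_of_nonneg (mul_nonneg (Real.rpow_nonneg (abs_nonneg x) _)
      (studentTDensity_pos hν x).le)]
  have hx1 : 0 < 1 + x ^ 2 := by positivity
  have h1 : |x| ^ p ≤ (1 + x ^ 2) ^ (p / 2) := by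
    have : |x| ^ p = (x ^ 2) ^ (p / 2) := by
      rw [← sq_abs, ← Real.rpow_natCast, ← Real.rpow_mul (abs_nonneg x)]
      congr 1; push_cast; ring
    rw [this]
    exact Real.rpow_le_rpow (sq_nonneg x) (by linarith) (by linarith)
  calc |x| ^ p * studentTDensity ν x
      ≤ (1 + x ^ 2) ^ (p / 2) * (A * (1 + x ^ 2) ^ (-((ν + 1) / 2))) :=
        mul_le_mul h1 (hbound x) (studentTDensity_pos hν x).le (by positivity)
    _ = A * (1 + x ^ 2) ^ (-(ν + 1 - p) / 2) := by
        rw [mul_left_comm, ← Real.rpow_add hx1]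
        congr 2; ring

lemma integrable_sq_studentT (hν : 2 < ν) : Integrable (fun x : ℝ => x ^ 2) (studentT ν) := by
  simpa using integrable_abs_rpow_studentT (by linarith) zero_le_two hν

lemma integral_sq_studentT_pos (hν : 2 < ν) : 0 < ∫ x, x ^ 2 ∂(studentT ν) := by
  rw [integral_pos_iff_support_of_nonneg (fun x => sq_nonneg x) (integrable_sq_studentT hν)]
  refine pos_iff_ne_zero.2 fun h => ?_
  have h0 := absolutelyContinuous_studentT (by linarith) h
  have : (volume : Measure ℝ) (Set.Ioi 0) = 0 :=
    measure_mono_null (fun x hx => by simpa using (ne_of_gt hx)) h0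
  simp at this

end StudentT

/-! ### Events whose probability tends to one -/

section WithHighProbability

variable {Ω : Type*} [MeasurableSpace Ω] {μ : Measure Ω}

lemma tendsto_measure_not_of_ae_eventually [IsFiniteMeasure μ] {P : ℕ → Ω → Prop}
    (hP : ∀ n, MeasurableSet {ω | P n ω}) (h : ∀ᵐ ω ∂μ, ∀ᶠ n in atTop, P n ω) :
    Tendsto (fun n => μ {ω | ¬ P n ω}) atTop (𝓝 0) := by
  have := tendsto_measure_of_ae_tendsto_indicator_of_isFiniteMeasure (μ := μ) atTop
    (A := ∅) (As := fun n => {ω | ¬ P n ω}) MeasurableSet.empty (fun n => (hP n).compl) (by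
      filter_upwards [h] with ω hω
      filter_upwards [hω] with n hn
      simpa using hn)
  simpa using this

/-- Only monotonicity and subadditivity are used, so the events may be non-measurable, as they can
be for an arbitrary selection rule. -/
lemma measure_not_le_add {P Q R : Ω → Prop} (h : ∀ᵐ ω ∂μ, P ω → Q ω → R ω) :
    μ {ω | ¬ R ω} ≤ μ {ω | ¬ P ω} + μ {ω | ¬ Q ω} := by
  refine (measure_mono_ae ?_).trans (measure_union_le _ _)
  filter_upwards [h] with ω hω
  intro hR
  change ¬ R ω at hR
  by_cases hP : P ω
  · exact Or.inr fun hQ => hR (hω hP hQ)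
  · exact Or.inl hP

lemma eventually_measure_not_le {P R : ℕ → Ω → Prop}
    (hP : Tendsto (fun n => μ {ω | ¬ P n ω}) atTop (𝓝 0))
    (h : ∀ᶠ n in atTop, ∀ᵐ ω ∂μ, P n ω → R n ω) {ε : ℝ} (hε : 0 < ε) :
    ∀ᶠ n in atTop, μ {ω | ¬ R n ω} ≤ ENNReal.ofReal ε := by
  filter_upwards [h, hP.eventually (ge_mem_nhds (ENNReal.ofReal_pos.2 hε))] with n hn hPn
  refine (measure_mono_ae ?_).trans hPn
  filter_upwards [hn] with ω hω hR hP'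
  exact hR (hω hP')

lemma eventually_measure_not_le_of_add {P Q R : ℕ → Ω → Prop} {ε : ℝ} (hε : 0 < ε)
    (hP : Tendsto (fun n => μ {ω | ¬ P n ω}) atTop (𝓝 0))
    (hQ : ∀ᶠ n in atTop, μ {ω | ¬ Q n ω} ≤ ENNReal.ofReal (ε / 2))
    (h : ∀ᶠ n in atTop, ∀ᵐ ω ∂μ, P n ω → Q n ω → R n ω) :
    ∀ᶠ n in atTop, μ {ω | ¬ R n ω} ≤ ENNReal.ofReal ε := by
  filter_upwards [h, hQ, hP.eventually (ge_mem_nhds (ENNReal.ofReal_pos.2 (half_pos hε)))]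
    with n hn hQn hPn
  refine (measure_not_le_add hn).trans ((add_le_add hPn hQn).trans ?_)
  rw [← ENNReal.ofReal_add (by positivity) (by positivity), add_halves]

lemma tendsto_measure_not_and {P Q : ℕ → Ω → Prop}
    (hP : Tendsto (fun n => μ {ω | ¬ P n ω}) atTop (𝓝 0))
    (hQ : Tendsto (fun n => μ {ω | ¬ Q n ω}) atTop (𝓝 0)) :
    Tendsto (fun n => μ {ω | ¬ (P n ω ∧ Q n ω)}) atTop (𝓝 0) :=
  tendsto_of_tendsto_of_tendsto_of_le_of_le tendsto_const_nhds (by simpa using hP.add hQ)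
    (fun _ => zero_le) fun _ => measure_not_le_add (ae_of_all _ fun _ => And.intro)

end WithHighProbability

/-! ### Samples from Student's `t` distribution -/

section Sample

/-- The nonpositive and the positive entries of `Z` both make up at most the proportion `θ`. -/
def IsBalanced {n : ℕ} (θ : ℝ) (Z : Fin n → ℝ) : Prop :=
  ((Finset.univ.filter fun i => Z i ≤ 0).card : ℝ) ≤ θ * n ∧
    ((Finset.univ.filter fun i => 0 < Z i).card : ℝ) ≤ θ * n

lemma measurableSet_isBalanced {n : ℕ} (θ : ℝ) : MeasurableSet {Z : Fin n → ℝ | IsBalanced θ Z} := by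
  have h : ∀ s : Set ℝ, MeasurableSet s → ∀ [DecidablePred (· ∈ s)],
      Measurable fun Z : Fin n → ℝ => ((Finset.univ.filter fun i => Z i ∈ s).card : ℝ) := by
    intro s hs _
    have : (fun Z : Fin n → ℝ => ((Finset.univ.filter fun i => Z i ∈ s).card : ℝ)) =
        fun Z => ∑ i, s.indicator (fun _ => (1 : ℝ)) (Z i) := by
      funext Z
      simp [Set.indicator_apply]
    rw [this]
    exact Finset.measurable_sum _ fun i _ =>
      (measurable_const.indicator hs).comp (measurable_pi_apply i)
  exact (measurableSet_le (h (Set.Iic 0) measurableSet_Iic) measurable_const).inter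
    (measurableSet_le (h (Set.Ioi 0) measurableSet_Ioi) measurable_const)

variable {Ω : Type*} [MeasurableSpace Ω] {μ : Measure Ω} {ν : ℝ}
  {z : ℕ → Ω → ℝ}

lemma isProbabilityMeasure_studentT [IsProbabilityMeasure μ] (hz : ∀ i, Measurable (z i))
    (hlaw : ∀ i, μ.map (z i) = studentT ν) : IsProbabilityMeasure (studentT ν) :=
  hlaw 0 ▸ Measure.isProbabilityMeasure_map (hz 0).aemeasurable

lemma ae_tendsto_average (hz : ∀ i, Measurable (z i)) (hind : iIndepFun z μ)
    (hlaw : ∀ i, μ.map (z i) = studentT ν) {g : ℝ → ℝ} (hg : Measurable g)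
    (hint : Integrable g (studentT ν)) :
    ∀ᵐ ω ∂μ, Tendsto (fun n : ℕ => (∑ i, g (firstTerms z n ω i)) / n) atTop
      (𝓝 (∫ x, g x ∂(studentT ν))) := by
  have h := strong_law_ae_real (μ := μ) (fun i ω => g (z i ω))
    (by
      rw [← hlaw 0] at hint
      exact hint.comp_measurable (hz 0))
    (fun i j hij => (hind.indepFun hij).comp hg hg)
    (fun i => IdentDistrib.comp ⟨(hz i).aemeasurable, (hz 0).aemeasurable, by rw [hlaw, hlaw]⟩ hg)
  rw [← hlaw 0, integral_map (hz 0).aemeasurable hg.aestronglyMeasurable]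
  filter_upwards [h] with ω hω
  simpa only [firstTerms, Fin.sum_univ_eq_sum_range (fun i => g (z i ω))] using hω

lemma ae_ne_zero (hz : ∀ i, Measurable (z i)) (hlaw : ∀ i, μ.map (z i) = studentT ν) :
    ∀ᵐ ω ∂μ, ∀ i, z i ω ≠ 0 := by
  rw [ae_all_iff]
  intro i
  have h : μ (z i ⁻¹' {0}) = 0 := by
    rw [← Measure.map_apply (hz i) (measurableSet_singleton 0), hlaw, studentT_singleton]
  exact measure_eq_zero_iff_ae_notMem.1 h

lemma ae_injective [IsProbabilityMeasure μ] (hz : ∀ i, Measurable (z i)) (hind : iIndepFun z μ)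
    (hlaw : ∀ i, μ.map (z i) = studentT ν) :
    ∀ᵐ ω ∂μ, Function.Injective fun i => z i ω := by
  have hp := isProbabilityMeasure_studentT hz hlaw
  have h : ∀ i j, ∀ᵐ ω ∂μ, i ≠ j → z i ω ≠ z j ω := by
    intro i j
    by_cases hij : i = j
    · simp [hij]
    have hd : MeasurableSet {p : ℝ × ℝ | p.1 = p.2} := measurableSet_eq_fun measurable_fst measurable_snd
    have h0 : μ ((fun ω => (z i ω, z j ω)) ⁻¹' {p : ℝ × ℝ | p.1 = p.2}) = 0 := by
      rw [← Measure.map_apply ((hz i).prodMk (hz j)) hd,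
        (indepFun_iff_map_prod_eq_prod_map_map (hz i).aemeasurable (hz j).aemeasurable).1
          (hind.indepFun hij), hlaw, hlaw, Measure.prod_apply hd]
      have : ∀ x : ℝ, Prod.mk x ⁻¹' {p : ℝ × ℝ | p.1 = p.2} = {x} := by
        intro x; ext y; simp [eq_comm]
      simp [this, studentT_singleton]
    filter_upwards [measure_eq_zero_iff_ae_notMem.1 h0] with ω hω _
    exact hω
  simp_rw [← ae_all_iff] at h
  filter_upwards [h] with ω hω i j hij
  by_contra hne
  exact hω i j hne hij

/-- The density is positive everywhere, so both half-lines have mass below 1 and θ fits above the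
two masses. The strong law is applied to indicators, hence no moment of z is needed. -/
lemma exists_ae_eventually_isBalanced [IsProbabilityMeasure μ] (hν : 0 < ν) (hz : ∀ i, Measurable (z i))
    (hind : iIndepFun z μ) (hlaw : ∀ i, μ.map (z i) = studentT ν) :
    ∃ θ : ℝ, 0 < θ ∧ θ < 1 ∧ ∀ᵐ ω ∂μ, ∀ᶠ n in atTop, IsBalanced θ (firstTerms z n ω) := by
  have hp := isProbabilityMeasure_studentT hz hlaw
  have hne : ∀ s : Set ℝ, volume s ≠ 0 → 0 < (studentT ν).real s := fun s hs =>
    ENNReal.toReal_pos (fun h => hs (absolutelyContinuous_studentT hν h)) (measure_ne_top _ _)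
  have h1 : 0 < (studentT ν).real (Set.Iic 0) := hne _ (by simp)
  have h2 : 0 < (studentT ν).real (Set.Ioi 0) := hne _ (by simp)
  have hadd : (studentT ν).real (Set.Iic 0) + (studentT ν).real (Set.Ioi 0) = 1 := by
    rw [← Set.compl_Iic]; exact probReal_add_probReal_compl measurableSet_Iic
  obtain ⟨θ, hθ, hθ1⟩ := exists_between
    (max_lt (by linarith : (studentT ν).real (Set.Iic 0) < 1)
      (by linarith : (studentT ν).real (Set.Ioi 0) < 1))
  rw [max_lt_iff] at hθ
  have hcount : ∀ s : Set ℝ, MeasurableSet s → ∀ [DecidablePred (· ∈ s)],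
      (studentT ν).real s < θ → ∀ᵐ ω ∂μ, ∀ᶠ n : ℕ in atTop,
        ((Finset.univ.filter fun i => firstTerms z n ω i ∈ s).card : ℝ) ≤ θ * n := by
    intro s hs _ hlt
    filter_upwards [ae_tendsto_average hz hind hlaw (measurable_const.indicator hs)
      ((integrable_const (1 : ℝ)).indicator hs)] with ω hω
    rw [integral_indicator hs] at hω
    simp only [integral_const, MeasurableSet.univ, measureReal_restrict_apply, Set.univ_inter,
      smul_eq_mul, mul_one] at hω
    filter_upwards [hω.eventually (gt_mem_nhds hlt), eventually_gt_atTop 0] with n hn hn0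
    rw [div_lt_iff₀ (by exact_mod_cast hn0)] at hn
    refine le_trans (le_of_eq ?_) hn.le
    simp [Set.indicator_apply]
  refine ⟨θ, h1.trans hθ.1, hθ1, ?_⟩
  filter_upwards [hcount _ measurableSet_Iic hθ.1, hcount _ measurableSet_Ioi hθ.2] with ω ha hb
  filter_upwards [ha, hb] with n ha hb using ⟨ha, hb⟩

lemma measurable_firstTerms (hz : ∀ i, Measurable (z i)) (n : ℕ) : Measurable (firstTerms z n) :=
  measurable_pi_lambda _ fun i => hz i

lemma measure_preimage_eq_studentT (hz : ∀ i, Measurable (z i))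
    (hlaw : ∀ i, μ.map (z i) = studentT ν) (i : ℕ) {s : Set ℝ} (hs : MeasurableSet s) :
    μ (z i ⁻¹' s) = studentT ν s := by
  rw [← Measure.map_apply (hz i) hs, hlaw]

/-- The sample maximum of `|z i|` is at most of the order `n ^ (1 / ν)` in probability. -/
lemma exists_measure_not_abs_le (hν : 0 < ν) (hz : ∀ i, Measurable (z i))
    (hlaw : ∀ i, μ.map (z i) = studentT ν) {ε : ℝ} (hε : 0 < ε) :
    ∃ C : ℝ, 0 < C ∧ ∀ᶠ n : ℕ in atTop,
      μ {ω | ¬ ∀ i, |firstTerms z n ω i| ≤ C * (n : ℝ) ^ (1 / ν)} ≤ ENNReal.ofReal ε := by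
  obtain ⟨A, hA, htail⟩ := exists_studentT_tail_le hν
  -- This constant makes the union bound n A t^(-ν) equal to ε.
  refine ⟨(A / ε) ^ (1 / ν), by positivity, ?_⟩
  filter_upwards [eventually_gt_atTop 0] with n hn
  have hn0 : (0 : ℝ) < n := by exact_mod_cast hn
  set t := (A / ε) ^ (1 / ν) * (n : ℝ) ^ (1 / ν) with ht
  have ht0 : 0 < t := by positivity
  have htν : t ^ (-ν) = (A / ε)⁻¹ * (n : ℝ)⁻¹ := by
    rw [ht, ← Real.mul_rpow (by positivity) hn0.le, ← Real.rpow_mul (by positivity),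
      show 1 / ν * -ν = -1 by field_simp, Real.rpow_neg_one, mul_inv]
  have hmeas : MeasurableSet {x : ℝ | ¬ |x| ≤ t} :=
    (measurableSet_le measurable_norm measurable_const).compl
  have hset : {ω | ¬ ∀ i, |firstTerms z n ω i| ≤ t} =
      ⋃ i : Fin n, z i ⁻¹' {x : ℝ | ¬ |x| ≤ t} := by
    ext ω; simp [firstTerms]
  rw [hset]
  calc μ (⋃ i : Fin n, z i ⁻¹' {x : ℝ | ¬ |x| ≤ t})
      ≤ ∑ i : Fin n, μ (z i ⁻¹' {x : ℝ | ¬ |x| ≤ t}) := measure_iUnion_fintype_le _ _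
    _ = n * studentT ν {x : ℝ | ¬ |x| ≤ t} := by
        simp_rw [measure_preimage_eq_studentT hz hlaw _ hmeas]
        simp
    _ ≤ n * ENNReal.ofReal (A * t ^ (-ν)) := by gcongr; exact htail t ht0
    _ = ENNReal.ofReal ε := by
        rw [← ENNReal.ofReal_natCast, ← ENNReal.ofReal_mul hn0.le, htν]
        congr 1
        field_simp

/-- The sample maximum of `|z i|` is at least of the order `n ^ (1 / ν)` in probability. -/
lemma exists_measure_not_exists_le_abs [IsProbabilityMeasure μ] (hν : 0 < ν) (hz : ∀ i, Measurable (z i))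
    (hind : iIndepFun z μ) (hlaw : ∀ i, μ.map (z i) = studentT ν) {ε : ℝ} (hε : 0 < ε) :
    ∃ c : ℝ, 0 < c ∧ ∀ᶠ n : ℕ in atTop,
      μ {ω | ¬ ∃ i, c * (n : ℝ) ^ (1 / ν) ≤ |firstTerms z n ω i|} ≤ ENNReal.ofReal ε := by
  have hp := isProbabilityMeasure_studentT hz hlaw
  obtain ⟨B, hB, htail⟩ := exists_le_studentT_tail hν
  obtain ⟨m, hm0, hm⟩ : ∃ m : ℝ, 0 < m ∧ Real.exp (-m) ≤ ε :=
    ((eventually_gt_atTop 0).and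
      (Real.tendsto_exp_neg_atTop_nhds_zero.eventually (ge_mem_nhds hε))).exists
  have hc0 : 0 < (B / m) ^ (1 / ν) := by positivity
  -- With this constant the tail probability is at least m / n, so by independence all n points stay
  -- below t with probability at most (1 - m/n)^n ≤ exp(-m) ≤ ε.
  refine ⟨(B / m) ^ (1 / ν), hc0, ?_⟩
  have hlarge : Tendsto (fun n : ℕ => (B / m) ^ (1 / ν) * (n : ℝ) ^ (1 / ν)) atTop atTop :=
    ((tendsto_rpow_atTop (by positivity)).comp tendsto_natCast_atTop_atTop).const_mul_atTop hc0
  filter_upwards [hlarge.eventually_ge_atTop 1, eventually_gt_atTop 0,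
    tendsto_natCast_atTop_atTop.eventually_ge_atTop m] with n ht1 hn hnm
  have hn0 : (0 : ℝ) < n := by exact_mod_cast hn
  set t := (B / m) ^ (1 / ν) * (n : ℝ) ^ (1 / ν) with ht
  have htν : B * t ^ (-ν) = m / n := by
    rw [ht, ← Real.mul_rpow (by positivity) hn0.le, ← Real.rpow_mul (by positivity),
      show 1 / ν * -ν = -1 by field_simp, Real.rpow_neg_one]
    field_simp
  have hmeas : MeasurableSet {x : ℝ | t ≤ |x|} := measurableSet_le measurable_const measurable_norm
  have hset : {ω | ¬ ∃ i, t ≤ |firstTerms z n ω i|} =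
      ⋂ i ∈ Finset.range n, z i ⁻¹' {x : ℝ | t ≤ |x|}ᶜ := by
    ext ω
    simp only [not_exists, firstTerms, Set.mem_ofPred_eq, Finset.mem_range, Set.mem_iInter,
      Set.mem_preimage, Set.mem_compl_iff]
    exact ⟨fun h i hi => h ⟨i, hi⟩, fun h i => h i i.2⟩
  rw [hset, hind.measure_inter_preimage_eq_mul _ fun _ _ => hmeas.compl]
  simp only [measure_preimage_eq_studentT hz hlaw _ hmeas.compl, Finset.prod_const,
    Finset.card_range]
  have hle : studentT ν {x : ℝ | t ≤ |x|}ᶜ ≤ ENNReal.ofReal (1 - m / n) := by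
    rw [prob_compl_eq_one_sub hmeas, ENNReal.ofReal_sub _ (by positivity), ENNReal.ofReal_one]
    exact tsub_le_tsub_left (htν ▸ htail t ht1) 1
  have hmn : 0 ≤ 1 - m / n := sub_nonneg.2 ((div_le_one hn0).2 hnm)
  calc studentT ν {x : ℝ | t ≤ |x|}ᶜ ^ n ≤ ENNReal.ofReal (1 - m / n) ^ n := by gcongr
    _ = ENNReal.ofReal ((1 - m / n) ^ n) := (ENNReal.ofReal_pow hmn n).symm
    _ ≤ ENNReal.ofReal ε :=
        ENNReal.ofReal_le_ofReal ((Real.one_sub_div_pow_le_exp_neg hnm).trans hm)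

/-- For `ν ≤ 2` the sum of squares grows at most like `n ^ (2 / ν + α)`. -/
lemma ae_tendsto_rpow_div_sum_sq (hν : 0 < ν) (hν2 : ν ≤ 2) (hz : ∀ i, Measurable (z i))
    (hind : iIndepFun z μ) (hlaw : ∀ i, μ.map (z i) = studentT ν) {α : ℝ} (hα : 0 < α) :
    ∀ᵐ ω ∂μ, Tendsto (fun n : ℕ => (n : ℝ) ^ (2 / ν + α) / ∑ i, firstTerms z n ω i ^ 2)
      atTop atTop := by
  -- The choice of q meets three demands: 2q < ν makes |z|^(2q) integrable, ν ≤ 2 gives q ≤ 1 for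
  -- subadditivity, and 1/q falls short of 2/ν + α by α/2, which leaves a divergent factor.
  set q : ℝ := 1 / (2 / ν + α / 2) with hq
  have h2ν : 1 ≤ 2 / ν := (one_le_div hν).2 hν2
  have hden : 0 < 2 / ν + α / 2 := by positivity
  have hq0 : 0 < q := by positivity
  have hq1 : q ≤ 1 := (div_le_one hden).2 (by linarith)
  have hqν : 2 * q < ν := by
    rw [hq, mul_one_div, div_lt_iff₀ hden, mul_add, mul_div_cancel₀ _ hν.ne']
    linarith [mul_pos hν (half_pos hα)]
  filter_upwards [ae_tendsto_average hz hind hlaw (g := fun x => |x| ^ (2 * q)) (by fun_prop)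
    (integrable_abs_rpow_studentT hν (by positivity) hqν), ae_ne_zero hz hlaw] with ω hω hne
  set a := ∫ x, |x| ^ (2 * q) ∂(studentT ν)
  have ha : 0 ≤ a := integral_nonneg fun x => by positivity
  have hlim : Tendsto (fun n : ℕ => (a + 1) ^ (-(1 / q)) * (n : ℝ) ^ (α / 2)) atTop atTop :=
    ((tendsto_rpow_atTop (by positivity)).comp tendsto_natCast_atTop_atTop).const_mul_atTop
      (by positivity)
  refine tendsto_atTop_mono' _ ?_ hlim
  filter_upwards [hω.eventually (gt_mem_nhds (lt_add_one a)), eventually_gt_atTop 0] with n hn hn0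
  have hn0' : (0 : ℝ) < n := by exact_mod_cast hn0
  rw [div_lt_iff₀ hn0'] at hn
  have hS : 0 < ∑ i, firstTerms z n ω i ^ 2 :=
    Finset.sum_pos (fun i _ => sq_pos_of_ne_zero (hne i)) ⟨⟨0, hn0⟩, Finset.mem_univ _⟩
  have h1 : (∑ i, firstTerms z n ω i ^ 2) ^ q ≤ (a + 1) * n := by
    refine (rpow_sum_le_sum_rpow _ _ (fun i _ => sq_nonneg _) hq0 hq1).trans (le_trans ?_ hn.le)
    refine Finset.sum_le_sum fun i _ => le_of_eq ?_
    rw [← sq_abs, ← Real.rpow_natCast, ← Real.rpow_mul (abs_nonneg _)]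
    norm_num
  have h2 : ∑ i, firstTerms z n ω i ^ 2 ≤ ((a + 1) * n) ^ (1 / q) := by
    rw [← Real.rpow_le_rpow_iff hS.le (by positivity) hq0, ← Real.rpow_mul (by positivity),
      one_div_mul_cancel hq0.ne', Real.rpow_one]
    exact h1
  rw [le_div_iff₀ hS]
  calc _ ≤ (a + 1) ^ (-(1 / q)) * (n : ℝ) ^ (α / 2) * ((a + 1) * n) ^ (1 / q) :=
        mul_le_mul_of_nonneg_left h2 (by positivity)
    _ = (n : ℝ) ^ (2 / ν + α) := by
        rw [Real.mul_rpow (by positivity) hn0'.le, Real.rpow_neg (by positivity), mul_mul_mul_comm,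
          inv_mul_cancel₀ (by positivity), one_mul, ← Real.rpow_add hn0', hq, one_div_one_div]
        congr 1; ring

end Sample

/-! ### Bounds for the diagonal of the inverse Gram matrix -/

section GramBounds

/-- The denominator lies between (1 - θ) s₀ s₂ and s₀ s₂. Hypothesis and denominator are symmetric
in s₀ and s₂, so one estimate serves intercept and slope. -/
lemma div_sub_sq_bounds {s₀ s₁ s₂ θ : ℝ} (h0 : 0 < s₀) (h2 : 0 < s₂) (hθ : θ < 1)
    (h : s₁ ^ 2 ≤ θ * (s₀ * s₂)) :
    1 / s₀ ≤ s₂ / (s₀ * s₂ - s₁ ^ 2) ∧ s₂ / (s₀ * s₂ - s₁ ^ 2) ≤ 1 / ((1 - θ) * s₀) := by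
  have hp : 0 < (1 - θ) * s₀ := mul_pos (by linarith) h0
  have hD : (1 - θ) * s₀ * s₂ ≤ s₀ * s₂ - s₁ ^ 2 := by linarith
  have hD0 : 0 < s₀ * s₂ - s₁ ^ 2 := (mul_pos hp h2).trans_le hD
  constructor
  · rw [div_le_div_iff₀ h0 hD0]; nlinarith [sq_nonneg s₁]
  · rw [div_le_div_iff₀ hD0 hp]; linarith

variable {n : ℕ} {Z w : Fin n → ℝ} {θ : ℝ}

lemma gramMatrix_inv_zero_bounds (h0 : 0 < ∑ i, w i) (h2 : 0 < ∑ i, w i * Z i ^ 2) (hθ : θ < 1)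
    (h : (∑ i, w i * Z i) ^ 2 ≤ θ * ((∑ i, w i) * ∑ i, w i * Z i ^ 2)) :
    1 / ∑ i, w i ≤ (gramMatrix Z w)⁻¹ 0 0 ∧
      (gramMatrix Z w)⁻¹ 0 0 ≤ 1 / ((1 - θ) * ∑ i, w i) := by
  rw [gramMatrix_inv_zero]
  exact div_sub_sq_bounds h0 h2 hθ h

lemma gramMatrix_inv_one_bounds (h0 : 0 < ∑ i, w i) (h2 : 0 < ∑ i, w i * Z i ^ 2) (hθ : θ < 1)
    (h : (∑ i, w i * Z i) ^ 2 ≤ θ * ((∑ i, w i) * ∑ i, w i * Z i ^ 2)) :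
    1 / ∑ i, w i * Z i ^ 2 ≤ (gramMatrix Z w)⁻¹ 1 1 ∧
      (gramMatrix Z w)⁻¹ 1 1 ≤ 1 / ((1 - θ) * ∑ i, w i * Z i ^ 2) := by
  rw [gramMatrix_inv_one]
  rw [mul_comm (∑ i, w i) (∑ i, w i * Z i ^ 2)] at h ⊢
  exact div_sub_sq_bounds h2 h0 hθ h

lemma IsBalanced.sq_sum_le (hb : IsBalanced θ Z) :
    (∑ i, Z i) ^ 2 ≤ θ * (n * ∑ i, Z i ^ 2) := by
  have hunion : (Finset.univ.filter fun i => Z i ≤ 0) ∪ (Finset.univ.filter fun i => 0 < Z i) =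
      Finset.univ := by
    ext i; simpa using le_or_gt (Z i) 0
  have h := sq_sum_le_of_sign (z := Z)
    (Finset.disjoint_filter.2 fun i _ h => not_lt.2 h :
      Disjoint (Finset.univ.filter fun i => Z i ≤ 0) (Finset.univ.filter fun i => 0 < Z i))
    (fun i hi => (Finset.mem_filter.1 hi).2) (fun i hi => (Finset.mem_filter.1 hi).2.le) hb.1 hb.2
  rwa [hunion, mul_assoc] at h

lemma IsBalanced.gramMatrix_one_inv_bounds (hb : IsBalanced θ Z) (hθ : θ < 1) (hn : 0 < n)
    (hZ : 0 < ∑ i, Z i ^ 2) :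
    (1 / (n : ℝ) ≤ (gramMatrix Z fun _ => 1)⁻¹ 0 0 ∧
      (gramMatrix Z fun _ => 1)⁻¹ 0 0 ≤ 1 / ((1 - θ) * n)) ∧
    (1 / ∑ i, Z i ^ 2 ≤ (gramMatrix Z fun _ => 1)⁻¹ 1 1 ∧
      (gramMatrix Z fun _ => 1)⁻¹ 1 1 ≤ 1 / ((1 - θ) * ∑ i, Z i ^ 2)) := by
  have hn0 : (0 : ℝ) < n := by exact_mod_cast hn
  have h0 := gramMatrix_inv_zero_bounds (Z := Z) (w := fun _ => 1) (θ := θ)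
  have h1 := gramMatrix_inv_one_bounds (Z := Z) (w := fun _ => 1) (θ := θ)
  simp only [Finset.sum_const, Finset.card_univ, Fintype.card_fin, nsmul_eq_mul, mul_one,
    one_mul] at h0 h1
  exact ⟨h0 hn0 hZ hθ hb.sq_sum_le, h1 hn0 hZ hθ hb.sq_sum_le⟩

lemma gramMatrix_average_inv (hn : n ≠ 0) (j : Fin 2) :
    (gramMatrix Z fun _ => 1 / (n : ℝ))⁻¹ j j = n * (gramMatrix Z fun _ => 1)⁻¹ j j := by
  have hn0 : (n : ℝ) ≠ 0 := by exact_mod_cast hn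
  have hsum : ∀ f : Fin n → ℝ, ∑ i, 1 / (n : ℝ) * f i = 1 / (n : ℝ) * ∑ i, f i := fun f =>
    (Finset.mul_sum _ _ _).symm
  have hone : ∑ _i : Fin n, 1 / (n : ℝ) = 1 := by simp [hn0]
  set a := ∑ i, Z i ^ 2 with ha
  set c := ∑ i, Z i with hc
  have hD : 1 / (n : ℝ) * a - (1 / (n : ℝ) * c) ^ 2 = (n * a - c ^ 2) / n ^ 2 := by
    field_simp
  fin_cases j
  · simp only [Fin.zero_eta, gramMatrix_inv_zero, hsum, hone]
    simp only [← ha, ← hc, one_mul, Finset.sum_const, Finset.card_univ, Fintype.card_fin,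
      nsmul_eq_mul, mul_one]
    rw [hD, div_div_eq_mul_div, ← mul_div_assoc]
    congr 1
    field_simp
  · simp only [Fin.mk_one, gramMatrix_inv_one, hsum, hone]
    simp only [← ha, ← hc, one_mul, Finset.sum_const, Finset.card_univ, Fintype.card_fin,
      nsmul_eq_mul, mul_one]
    rw [hD, div_div_eq_mul_div, ← mul_div_assoc]
    congr 1
    ring

/-- Subdata with the `r` smallest and the `r` largest covariates. -/
lemma IsExtremeSubdata.gramMatrix_inv_bounds {r : ℕ} {s : Finset (Fin n)}
    (hs : IsExtremeSubdata r Z s) (hb : IsBalanced θ Z) (hZ : ∀ i, Z i ≠ 0) (hr : 1 ≤ r)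
    (hrn : (r : ℝ) ≤ (1 - θ) * n) :
    (1 / ((2 * r : ℕ) : ℝ) ≤ (gramMatrix Z fun i => if i ∈ s then 1 else 0)⁻¹ 0 0 ∧
      (gramMatrix Z fun i => if i ∈ s then 1 else 0)⁻¹ 0 0 ≤ 2 * (1 / ((2 * r : ℕ) : ℝ))) ∧
    (1 / ∑ i ∈ s, Z i ^ 2 ≤ (gramMatrix Z fun i => if i ∈ s then 1 else 0)⁻¹ 1 1 ∧
      (gramMatrix Z fun i => if i ∈ s then 1 else 0)⁻¹ 1 1 ≤ 2 * (1 / ∑ i ∈ s, Z i ^ 2)) := by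
  obtain ⟨L, U, hd, rfl, hLr, hUr, hL, hU⟩ := hs
  have hcard : ((Finset.univ.filter fun i => Z i ≤ 0).card : ℝ) +
      (Finset.univ.filter fun i => 0 < Z i).card = n := by
    have := Finset.card_filter_add_card_filter_not (s := (Finset.univ : Finset (Fin n)))
      (fun i => Z i ≤ 0)
    simp only [not_le, Finset.card_univ, Fintype.card_fin] at this
    exact_mod_cast this
  -- A positive value in `L` would force every nonpositive point into the rest of `L`, leaving at
  -- most r - 1 of them; balance guarantees at least (1 - θ) n ≥ r.
  have hnonpos : ∀ i ∈ L, Z i ≤ 0 := by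
    intro i hi
    by_contra! hpos
    have hsub : (Finset.univ.filter fun i => Z i ≤ 0) ⊆ L.erase i := by
      intro j hj
      have hj' := (Finset.mem_filter.1 hj).2
      refine Finset.mem_erase.2 ⟨fun h => (h ▸ hj').not_gt hpos, ?_⟩
      by_contra hjL
      linarith [hL i hi j hjL]
    have h1 := Finset.card_le_card hsub
    rw [Finset.card_erase_of_mem hi, hLr] at h1
    have h2 : ((Finset.univ.filter fun i => Z i ≤ 0).card : ℝ) + 1 ≤ r := by
      exact_mod_cast (by omega)
    linarith [hb.2]
  have hnonneg : ∀ i ∈ U, 0 ≤ Z i := by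
    intro i hi
    by_contra! hneg
    have hsub : (Finset.univ.filter fun i => 0 < Z i) ⊆ U.erase i := by
      intro j hj
      have hj' := (Finset.mem_filter.1 hj).2
      refine Finset.mem_erase.2 ⟨fun h => (h ▸ hj').not_gt hneg, ?_⟩
      by_contra hjU
      linarith [hU i hi j hjU]
    have h1 := Finset.card_le_card hsub
    rw [Finset.card_erase_of_mem hi, hUr] at h1
    have h2 : ((Finset.univ.filter fun i => 0 < Z i).card : ℝ) + 1 ≤ r := by
      exact_mod_cast (by omega)
    linarith [hb.1]
  -- Each sign class has r of the 2r points, whence θ = 1/2 below and the factor 2 in the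
  -- conclusion.
  have hsq := sq_sum_le_of_sign hd hnonpos hnonneg (m := r) (by rw [hLr]) (by rw [hUr])
  have hcardLU : (L ∪ U).card = 2 * r := by rw [Finset.card_union_of_disjoint hd, hLr, hUr]; ring
  have hne : (L ∪ U).Nonempty := Finset.card_pos.1 (by omega)
  have hpos : 0 < ∑ i ∈ L ∪ U, Z i ^ 2 :=
    Finset.sum_pos (fun i _ => by have := hZ i; positivity) hne
  have hr0 : (0 : ℝ) < ((2 * r : ℕ) : ℝ) := by exact_mod_cast (by omega)
  have h0 := gramMatrix_inv_zero_bounds (Z := Z) (w := fun i => if i ∈ L ∪ U then 1 else 0)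
    (θ := 1 / 2)
  have h1 := gramMatrix_inv_one_bounds (Z := Z) (w := fun i => if i ∈ L ∪ U then 1 else 0)
    (θ := 1 / 2)
  simp only [ite_mul, one_mul, zero_mul, Finset.sum_ite_mem, Finset.univ_inter, Finset.sum_const,
    hcardLU, nsmul_eq_mul, mul_one] at h0 h1
  have hsq' : (∑ i ∈ L ∪ U, Z i) ^ 2 ≤ 1 / 2 * (((2 * r : ℕ) : ℝ) * ∑ i ∈ L ∪ U, Z i ^ 2) := by
    refine hsq.trans (le_of_eq ?_)
    push_cast; ring
  have hhalf : ∀ x : ℝ, 1 / ((1 - 1 / 2) * x) = 2 * (1 / x) := fun x => by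
    rw [one_div, mul_inv, one_div]; norm_num
  rw [hhalf] at h0 h1
  exact ⟨h0 hr0 hpos (by norm_num) hsq', h1 hr0 hpos (by norm_num) hsq'⟩

/-- An unselected nonnegative value is dominated by any member of `U`, an unselected nonpositive one
by any member of `L`. So some selected point is at least as extreme, and its square alone gives the
bound. -/
lemma IsExtremeSubdata.sq_le_sum {r : ℕ} {s : Finset (Fin n)} (hs : IsExtremeSubdata r Z s)
    (hr : 1 ≤ r) {t : ℝ} (ht : 0 ≤ t) {i : Fin n} (hi : t ≤ |Z i|) : t ^ 2 ≤ ∑ i ∈ s, Z i ^ 2 := by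
  obtain ⟨L, U, hd, rfl, hLr, hUr, hL, hU⟩ := hs
  suffices h : ∃ j ∈ L ∪ U, t ≤ |Z j| by
    obtain ⟨j, hj, htj⟩ := h
    refine le_trans ?_ (Finset.single_le_sum (f := fun i => Z i ^ 2) (fun i _ => sq_nonneg _) hj)
    rw [← sq_abs (Z j)]
    exact pow_le_pow_left₀ ht htj 2
  rcases le_total 0 (Z i) with h0 | h0
  · by_cases hiU : i ∈ U
    · exact ⟨i, Finset.mem_union_right _ hiU, hi⟩
    obtain ⟨j, hj⟩ : U.Nonempty := Finset.card_pos.1 (by omega)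
    refine ⟨j, Finset.mem_union_right _ hj, hi.trans ?_⟩
    rw [abs_of_nonneg h0]
    exact (hU j hj i hiU).trans (le_abs_self _)
  · by_cases hiL : i ∈ L
    · exact ⟨i, Finset.mem_union_left _ hiL, hi⟩
    obtain ⟨j, hj⟩ : L.Nonempty := Finset.card_pos.1 (by omega)
    refine ⟨j, Finset.mem_union_left _ hj, hi.trans ?_⟩
    rw [abs_of_nonpos h0]
    exact (neg_le_neg (hL j hj i hiL)).trans (neg_le_abs _)

lemma IsExtremeSubdata.sum_sq_le {r : ℕ} {s : Finset (Fin n)} (hs : IsExtremeSubdata r Z s)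
    {t : ℝ} (ht : ∀ i, |Z i| ≤ t) : ∑ i ∈ s, Z i ^ 2 ≤ ((2 * r : ℕ) : ℝ) * t ^ 2 := by
  obtain ⟨L, U, hd, rfl, hLr, hUr, -, -⟩ := hs
  have hcardLU : (L ∪ U).card = 2 * r := by rw [Finset.card_union_of_disjoint hd, hLr, hUr]; ring
  rw [← hcardLU, ← nsmul_eq_mul]
  refine Finset.sum_le_card_nsmul _ _ _ fun i _ => ?_
  rw [← sq_abs (Z i)]
  exact pow_le_pow_left₀ (abs_nonneg _) (ht i) 2

lemma sum_firstTerms_sq_pos {Ω : Type*} {z : ℕ → Ω → ℝ} {ω : Ω} (hω : ∀ i, z i ω ≠ 0) {n : ℕ} (hn : 0 < n) :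
    0 < ∑ i, firstTerms z n ω i ^ 2 :=
  Finset.sum_pos (fun i _ => sq_pos_of_ne_zero (hω i)) ⟨⟨0, hn⟩, Finset.mem_univ _⟩

end GramBounds

/-! ### Orders of the conditional variances -/

section Orders

variable {Ω : Type*} [MeasurableSpace Ω] {μ : Measure Ω} [IsProbabilityMeasure μ] {ν σ θ : ℝ}
  {b : Fin 2 → ℝ} {z e : ℕ → Ω → ℝ} {sel : (r n : ℕ) → (Fin n → ℝ) → Finset (Fin n)}

lemma tendsto_measure_not_isBalanced (hz : ∀ i, Measurable (z i))
    (hb : ∀ᵐ ω ∂μ, ∀ᶠ n in atTop, IsBalanced θ (firstTerms z n ω)) :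
    Tendsto (fun n => μ {ω | ¬ IsBalanced θ (firstTerms z n ω)}) atTop (𝓝 0) :=
  tendsto_measure_not_of_ae_eventually
    (fun n => measurable_firstTerms hz n (measurableSet_isBalanced θ)) hb

lemma tendsto_measure_not_sum_sq (hν : 2 < ν) (hz : ∀ i, Measurable (z i))
    (hind : iIndepFun z μ) (hlaw : ∀ i, μ.map (z i) = studentT ν) :
    ∃ m : ℝ, 0 < m ∧ Tendsto (fun n : ℕ => μ {ω | ¬ (m / 2 * n ≤ ∑ i, firstTerms z n ω i ^ 2 ∧
      ∑ i, firstTerms z n ω i ^ 2 ≤ 2 * m * n)}) atTop (𝓝 0) := by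
  have hm := integral_sq_studentT_pos hν
  refine ⟨_, hm, tendsto_measure_not_of_ae_eventually (fun n => ?_) ?_⟩
  · have hS : Measurable fun ω => ∑ i, firstTerms z n ω i ^ 2 :=
      Finset.measurable_sum _ fun i _ => (hz i).pow_const 2
    exact (measurableSet_le measurable_const hS).inter (measurableSet_le hS measurable_const)
  · filter_upwards [ae_tendsto_average hz hind hlaw (g := fun x => x ^ 2) (by fun_prop)
      (integrable_sq_studentT hν)] with ω hω
    filter_upwards [hω.eventually (lt_mem_nhds (half_lt_self hm)),
      hω.eventually (gt_mem_nhds (lt_mul_of_one_lt_left hm one_lt_two)),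
      eventually_gt_atTop 0] with n h1 h2 hn
    have hn0 : (0 : ℝ) < n := by exact_mod_cast hn
    exact ⟨((lt_div_iff₀ hn0).1 h1).le, ((div_lt_iff₀ hn0).1 h2).le⟩

lemma ae_fullCondVar_bounds (hz : ∀ i, Measurable (z i))
    (hlaw : ∀ i, μ.map (z i) = studentT ν) (he : IsRegressionError μ σ z e) (hθ : θ < 1) :
    ∀ᵐ ω ∂μ, ∀ n : ℕ, 0 < n → IsBalanced θ (firstTerms z n ω) →
      (σ ^ 2 * (1 / n) ≤ fullCondVar μ z e b 0 n ω ∧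
        fullCondVar μ z e b 0 n ω ≤ σ ^ 2 / (1 - θ) * (1 / n)) ∧
      (σ ^ 2 * (1 / ∑ i, firstTerms z n ω i ^ 2) ≤ fullCondVar μ z e b 1 n ω ∧
        fullCondVar μ z e b 1 n ω ≤
          σ ^ 2 / (1 - θ) * (1 / ∑ i, firstTerms z n ω i ^ 2)) := by
  filter_upwards [ae_lsCondVar_eq hz he, ae_ne_zero hz hlaw] with ω hV hne n hn hbal
  obtain ⟨⟨h1, h2⟩, h3, h4⟩ := hbal.gramMatrix_one_inv_bounds hθ hn (sum_firstTerms_sq_pos hne hn)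
  unfold fullCondVar
  rw [hV _ _ _ _ fun _ _ => one_pow 2, hV _ _ _ _ fun _ _ => one_pow 2]
  have hσ2 : 0 ≤ σ ^ 2 := sq_nonneg σ
  have hre : ∀ x : ℝ, σ ^ 2 / (1 - θ) * (1 / x) = σ ^ 2 * (1 / ((1 - θ) * x)) := fun x => by
    rw [div_mul_div_comm, mul_one, mul_one_div]
  rw [hre, hre]
  exact ⟨⟨mul_le_mul_of_nonneg_left h1 hσ2, mul_le_mul_of_nonneg_left h2 hσ2⟩,
    mul_le_mul_of_nonneg_left h3 hσ2, mul_le_mul_of_nonneg_left h4 hσ2⟩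

lemma ae_uniLowerBound_bounds (hz : ∀ i, Measurable (z i)) (hind : iIndepFun z μ)
    (hlaw : ∀ i, μ.map (z i) = studentT ν) (hθ : θ < 1) :
    ∀ᵐ ω ∂μ, ∀ (repl : Bool) (k n : ℕ), 2 ≤ k → k ≤ n → IsBalanced θ (firstTerms z n ω) →
      (σ ^ 2 / 2 * (1 / k) ≤ uniLowerBound σ z repl 0 k n ω ∧
        uniLowerBound σ z repl 0 k n ω ≤ σ ^ 2 / (1 - θ) * (1 / k)) ∧
      (σ ^ 2 / 2 * (n / ∑ i, firstTerms z n ω i ^ 2) * (1 / k) ≤ uniLowerBound σ z repl 1 k n ω ∧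
        uniLowerBound σ z repl 1 k n ω ≤
          σ ^ 2 / (1 - θ) * (n / ∑ i, firstTerms z n ω i ^ 2) * (1 / k)) := by
  filter_upwards [ae_injective hz hind hlaw, ae_ne_zero hz hlaw] with ω hinj hne repl k n hk hkn hbal
  have hn : 0 < n := by omega
  have hn0 : (0 : ℝ) < n := by exact_mod_cast hn
  have hk0 : (0 : ℝ) < k := by exact_mod_cast (by omega : 0 < k)
  have hU := isProbabilityMeasure_uniformDraws repl hkn
  have hS := sum_firstTerms_sq_pos hne hn
  obtain ⟨⟨h1, h2⟩, h3, h4⟩ := hbal.gramMatrix_one_inv_bounds hθ hn hS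
  have hp : 1 / 2 ≤ (uniformDraws repl n k).real (fullRankDraws k (firstTerms z n ω)) :=
    half_le_fullRankDraws repl hk hkn fun i j hij => Fin.ext (hinj hij)
  have hp1 : (uniformDraws repl n k).real (fullRankDraws k (firstTerms z n ω)) ≤ 1 :=
    measureReal_le_one
  unfold uniLowerBound
  rw [gramMatrix_average_inv hn.ne', gramMatrix_average_inv hn.ne']
  set p := (uniformDraws repl n k).real (fullRankDraws k (firstTerms z n ω))
  set S := ∑ i, firstTerms z n ω i ^ 2
  -- Used with t = n for the intercept and t = ∑ z² for the slope.
  have key : ∀ g t : ℝ, 0 < t → 1 / t ≤ g → g ≤ 1 / ((1 - θ) * t) →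
      σ ^ 2 / 2 * (n / t) * (1 / k) ≤ σ ^ 2 * p / k * (n * g) ∧
      σ ^ 2 * p / k * (n * g) ≤ σ ^ 2 / (1 - θ) * (n / t) * (1 / k) := by
    intro g t ht hg1 hg2
    have hθ' : 0 < 1 - θ := by linarith
    have hg : 0 ≤ g := le_trans (by positivity) hg1
    have hc : 0 ≤ σ ^ 2 * n / k := by positivity
    have e1 : σ ^ 2 / 2 * (n / t) * (1 / k) = σ ^ 2 * n / k * (1 / 2 * (1 / t)) := by
      field_simp
    have e2 : σ ^ 2 * p / k * (n * g) = σ ^ 2 * n / k * (p * g) := by ring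
    have e3 : σ ^ 2 / (1 - θ) * (n / t) * (1 / k) = σ ^ 2 * n / k * (1 * (1 / ((1 - θ) * t))) := by
      field_simp
    rw [e1, e2, e3]
    exact ⟨mul_le_mul_of_nonneg_left
        (mul_le_mul hp hg1 (by positivity) (le_trans (by norm_num) hp)) hc,
      mul_le_mul_of_nonneg_left (mul_le_mul hp1 hg2 hg zero_le_one) hc⟩
  have h0 := key _ _ hn0 h1 h2
  rw [div_self hn0.ne', mul_one, mul_one] at h0
  exact ⟨h0, key _ _ hS h3 h4⟩

lemma eventually_ae_ibossCondVar_bounds (hz : ∀ i, Measurable (z i))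
    (hlaw : ∀ i, μ.map (z i) = studentT ν) (he : IsRegressionError μ σ z e)
    (hsel : IsIBOSSRule sel) (hθ : θ < 1) {r : ℕ} (hr : 1 ≤ r) :
    ∀ᶠ n : ℕ in atTop, 0 < n ∧ ∀ᵐ ω ∂μ, IsBalanced θ (firstTerms z n ω) →
      IsExtremeSubdata r (firstTerms z n ω) (sel r n (firstTerms z n ω)) ∧
      0 < ∑ i ∈ sel r n (firstTerms z n ω), firstTerms z n ω i ^ 2 ∧
      (σ ^ 2 * (1 / ((2 * r : ℕ) : ℝ)) ≤ ibossCondVar μ z e b sel 0 r n ω ∧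
        ibossCondVar μ z e b sel 0 r n ω ≤ 2 * σ ^ 2 * (1 / ((2 * r : ℕ) : ℝ))) ∧
      (σ ^ 2 * (1 / ∑ i ∈ sel r n (firstTerms z n ω), firstTerms z n ω i ^ 2) ≤
          ibossCondVar μ z e b sel 1 r n ω ∧
        ibossCondVar μ z e b sel 1 r n ω ≤
          2 * σ ^ 2 * (1 / ∑ i ∈ sel r n (firstTerms z n ω), firstTerms z n ω i ^ 2)) := by
  have hlarge : Tendsto (fun n : ℕ => (1 - θ) * (n : ℝ)) atTop atTop :=
    tendsto_natCast_atTop_atTop.const_mul_atTop (by linarith)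
  filter_upwards [hlarge.eventually_ge_atTop (r : ℝ), eventually_ge_atTop (2 * r)] with n hrn h2r
  refine ⟨by omega, ?_⟩
  filter_upwards [ae_lsCondVar_eq hz he, ae_ne_zero hz hlaw] with ω hV hne hbal
  have hs := hsel r n (firstTerms z n ω) hr h2r
  obtain ⟨⟨h1, h2⟩, h3, h4⟩ := hs.gramMatrix_inv_bounds hbal (fun i => hne i) hr hrn
  have hw : ∀ (Z : Fin n → ℝ) (i : Fin n),
      (if i ∈ sel r n Z then (1 : ℝ) else 0) ^ 2 = if i ∈ sel r n Z then 1 else 0 := by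
    intro Z i; split_ifs <;> norm_num
  unfold ibossCondVar
  rw [hV _ _ _ _ hw, hV _ _ _ _ hw]
  have hσ2 : 0 ≤ σ ^ 2 := sq_nonneg σ
  have hre : ∀ x : ℝ, 2 * σ ^ 2 * x = σ ^ 2 * (2 * x) := fun x => by ring
  rw [hre, hre]
  refine ⟨hs, ?_, ⟨mul_le_mul_of_nonneg_left h1 hσ2, mul_le_mul_of_nonneg_left h2 hσ2⟩,
    mul_le_mul_of_nonneg_left h3 hσ2, mul_le_mul_of_nonneg_left h4 hσ2⟩
  obtain ⟨L, U, hd, hLU, hL, -⟩ := hs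
  refine Finset.sum_pos (fun i _ => sq_pos_of_ne_zero (hne i)) ?_
  rw [hLU]
  exact (Finset.card_pos.1 (by omega : 0 < L.card)).mono Finset.subset_union_left

theorem uniformOrderInProb_ibossCondVar_zero (hν : 0 < ν) (hσ : 0 < σ)
    (hz : ∀ i, Measurable (z i)) (hind : iIndepFun z μ) (hlaw : ∀ i, μ.map (z i) = studentT ν)
    (he : IsRegressionError μ σ z e) (hsel : IsIBOSSRule sel) :
    UniformOrderInProb μ {r | 1 ≤ r} (ibossCondVar μ z e b sel 0)
      (fun r _ => 1 / ((2 * r : ℕ) : ℝ)) := by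
  obtain ⟨θ, -, hθ, hbal⟩ := exists_ae_eventually_isBalanced hν hz hind hlaw
  -- These constants depend neither on r nor on ε: only the balance event is random.
  refine fun ε hε => ⟨σ ^ 2, 2 * σ ^ 2, by positivity, by positivity, fun r hr => ?_⟩
  refine eventually_measure_not_le (tendsto_measure_not_isBalanced hz hbal) ?_ hε
  filter_upwards [eventually_ae_ibossCondVar_bounds (b := b) hz hlaw he hsel hθ hr] with n hn
  filter_upwards [hn.2] with ω hω hb
  exact (hω hb).2.2.1

lemma exists_measure_not_ibossCondVar_one_le (hν : 0 < ν) (hσ : 0 < σ)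
    (hz : ∀ i, Measurable (z i)) (hind : iIndepFun z μ) (hlaw : ∀ i, μ.map (z i) = studentT ν)
    (he : IsRegressionError μ σ z e) (hsel : IsIBOSSRule sel) {r : ℕ} (hr : 1 ≤ r) {ε : ℝ}
    (hε : 0 < ε) :
    ∃ C : ℝ, 0 < C ∧ ∀ᶠ n : ℕ in atTop,
      μ {ω | ¬ ibossCondVar μ z e b sel 1 r n ω ≤
        C * (1 / (((2 * r : ℕ) : ℝ) * (n : ℝ) ^ (2 / ν)))} ≤ ENNReal.ofReal ε := by
  obtain ⟨θ, -, hθ, hbal⟩ := exists_ae_eventually_isBalanced hν hz hind hlaw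
  obtain ⟨c, hc, hmax⟩ := exists_measure_not_exists_le_abs hν hz hind hlaw (half_pos hε)
  have hr0 : (0 : ℝ) < ((2 * r : ℕ) : ℝ) := by exact_mod_cast (by omega)
  -- The factor 2r appears because only one selected square is bounded below; this upper constant is
  -- therefore not uniform in k.
  refine ⟨2 * σ ^ 2 * (2 * r : ℕ) / c ^ 2, by positivity, ?_⟩
  refine eventually_measure_not_le_of_add hε (tendsto_measure_not_isBalanced hz hbal) hmax ?_
  filter_upwards [eventually_ae_ibossCondVar_bounds (b := b) hz hlaw he hsel hθ hr] with n hn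
  filter_upwards [hn.2] with ω hω hb ⟨i, hi⟩
  obtain ⟨hs, hS, -, -, h4⟩ := hω hb
  have hn0 : (0 : ℝ) < n := by exact_mod_cast hn.1
  have h := hs.sq_le_sum hr (by positivity) hi
  have hpow : (c * (n : ℝ) ^ (1 / ν)) ^ 2 = c ^ 2 * (n : ℝ) ^ (2 / ν) := by
    rw [mul_pow, ← Real.rpow_natCast ((n : ℝ) ^ (1 / ν)), ← Real.rpow_mul hn0.le]
    congr 2; push_cast; ring
  rw [hpow] at h
  calc _ ≤ _ := h4
    _ ≤ 2 * σ ^ 2 * (1 / (c ^ 2 * (n : ℝ) ^ (2 / ν))) := by gcongr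
    _ = _ := by field_simp

theorem uniformLowerOrderInProb_ibossCondVar_one (hν : 0 < ν) (hσ : 0 < σ)
    (hz : ∀ i, Measurable (z i)) (hind : iIndepFun z μ) (hlaw : ∀ i, μ.map (z i) = studentT ν)
    (he : IsRegressionError μ σ z e) (hsel : IsIBOSSRule sel) :
    UniformLowerOrderInProb μ {r | 1 ≤ r} (ibossCondVar μ z e b sel 1)
      (fun r n => 1 / (((2 * r : ℕ) : ℝ) * (n : ℝ) ^ (2 / ν))) := by
  obtain ⟨θ, -, hθ, hbal⟩ := exists_ae_eventually_isBalanced hν hz hind hlaw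
  intro ε hε
  obtain ⟨C, hC, hmax⟩ := exists_measure_not_abs_le hν hz hlaw (half_pos hε)
  -- All 2r selected squares are at most C² n^(2/ν), so the factor k appears in the rate and the
  -- constant is free of r.
  refine ⟨σ ^ 2 / C ^ 2, by positivity, fun r hr => ?_⟩
  have hr0 : (0 : ℝ) < ((2 * r : ℕ) : ℝ) := by
    have : 1 ≤ r := hr
    exact_mod_cast (by omega)
  simp_rw [← not_le]
  refine eventually_measure_not_le_of_add hε (tendsto_measure_not_isBalanced hz hbal) hmax ?_
  filter_upwards [eventually_ae_ibossCondVar_bounds (b := b) hz hlaw he hsel hθ hr] with n hn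
  filter_upwards [hn.2] with ω hω hb hi
  obtain ⟨hs, hS, -, h3, -⟩ := hω hb
  have hn0 : (0 : ℝ) < n := by exact_mod_cast hn.1
  have h := hs.sum_sq_le hi
  have hpow : (C * (n : ℝ) ^ (1 / ν)) ^ 2 = C ^ 2 * (n : ℝ) ^ (2 / ν) := by
    rw [mul_pow, ← Real.rpow_natCast ((n : ℝ) ^ (1 / ν)), ← Real.rpow_mul hn0.le]
    congr 2; push_cast; ring
  rw [hpow] at h
  calc _ = σ ^ 2 * (1 / (((2 * r : ℕ) : ℝ) * (C ^ 2 * (n : ℝ) ^ (2 / ν)))) := by field_simp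
    _ ≤ σ ^ 2 * (1 / ∑ i ∈ sel r n (firstTerms z n ω), firstTerms z n ω i ^ 2) := by gcongr
    _ ≤ _ := h3

end Orders

/-! ### Assembly of the three sampling schemes -/

theorem mainTheorem7 {Ω : Type*} [MeasurableSpace Ω] (μ : Measure Ω) [IsProbabilityMeasure μ]
    (ν σ : ℝ) (hν : 0 < ν) (hσ : 0 < σ) (b : Fin 2 → ℝ) (z e : ℕ → Ω → ℝ)
    (hz_meas : ∀ i, Measurable (z i)) (hz_indep : iIndepFun z μ)
    (hz_law : ∀ i, μ.map (z i) = studentT ν)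
    (he : IsRegressionError μ σ z e)
    (sel : (r n : ℕ) → (Fin n → ℝ) → Finset (Fin n)) (hsel : IsIBOSSRule sel) :
    -- IBOSS, intercept: order `1 / k`, `k = 2 r`
    UniformOrderInProb μ {r | 1 ≤ r} (ibossCondVar μ z e b sel 0)
      (fun r _ => 1 / ((2 * r : ℕ) : ℝ)) ∧
    -- IBOSS, slope: order `1 / (k n ^ (2 / ν))`, `k = 2 r`
    (∀ r : ℕ, 1 ≤ r → OrderInProb μ (ibossCondVar μ z e b sel 1 r)
      (fun n => 1 / (((2 * r : ℕ) : ℝ) * (n : ℝ) ^ (2 / ν)))) ∧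
    UniformLowerOrderInProb μ {r | 1 ≤ r} (ibossCondVar μ z e b sel 1)
      (fun r n => 1 / (((2 * r : ℕ) : ℝ) * (n : ℝ) ^ (2 / ν))) ∧
    -- uniform subsampling, with or without replacement
    (∀ repl : Bool,
      (∀ (j : Fin 2) (k n : ℕ), 2 ≤ k → k ≤ n →
        ∀ᵐ ω ∂μ, uniLowerBound σ z repl j k n ω ≤ uniCondVar μ z e b repl j k n ω) ∧
      UniformOrderInProb μ {k | 2 ≤ k} (uniLowerBound σ z repl 0) (fun k _ => 1 / (k : ℝ)) ∧
      (2 < ν →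
        UniformOrderInProb μ {k | 2 ≤ k} (uniLowerBound σ z repl 1) (fun k _ => 1 / (k : ℝ))) ∧
      (ν ≤ 2 → ∀ α : ℝ, 0 < α → ∀ k : ℕ, 2 ≤ k → ∀ᵐ ω ∂μ,
        Tendsto (fun n : ℕ => (k : ℝ) * (n : ℝ) ^ (2 / ν - 1 + α) * uniLowerBound σ z repl 1 k n ω)
          atTop atTop)) ∧
    -- full data
    OrderInProb μ (fullCondVar μ z e b 0) (fun n => 1 / (n : ℝ)) ∧
    (2 < ν → OrderInProb μ (fullCondVar μ z e b 1) (fun n => 1 / (n : ℝ))) ∧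
    (ν ≤ 2 → ∀ α : ℝ, 0 < α → ∀ᵐ ω ∂μ,
      Tendsto (fun n : ℕ => (n : ℝ) ^ (2 / ν + α) * fullCondVar μ z e b 1 n ω) atTop atTop) := by
  obtain ⟨θ, -, hθ, hbal⟩ := exists_ae_eventually_isBalanced hν hz_meas hz_indep hz_law
  have hθ' : 0 < 1 - θ := by linarith
  have hbalP := tendsto_measure_not_isBalanced hz_meas hbal
  have hlow := uniformLowerOrderInProb_ibossCondVar_one (b := b) hν hσ hz_meas hz_indep hz_law he
    hsel
  have hfull := ae_fullCondVar_bounds (b := b) hz_meas hz_law he hθ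
  have huni := ae_uniLowerBound_bounds (σ := σ) hz_meas hz_indep hz_law hθ
  refine ⟨uniformOrderInProb_ibossCondVar_zero hν hσ hz_meas hz_indep hz_law he hsel, ?_, hlow,
    fun repl => ⟨fun j k n hk hkn => ae_uniLowerBound_le hz_meas he b repl j hk hkn, ?_, ?_, ?_⟩,
    ?_, ?_, ?_⟩
  · intro r hr ε hε
    obtain ⟨c, hc, h1⟩ := hlow (ε / 2) (half_pos hε)
    obtain ⟨C, hC, h2⟩ := exists_measure_not_ibossCondVar_one_le (b := b) hν hσ hz_meas hz_indep hz_law he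
      hsel hr (half_pos hε)
    refine ⟨c, C, hc, hC, ?_⟩
    filter_upwards [h1 r hr, h2] with n h1 h2
    simp_rw [← not_le] at h1
    refine (measure_not_le_add (ae_of_all _ fun _ => And.intro)).trans ((add_le_add h1 h2).trans ?_)
    rw [← ENNReal.ofReal_add (by positivity) (by positivity), add_halves]
  · refine fun ε hε => ⟨σ ^ 2 / 2, σ ^ 2 / (1 - θ), by positivity, by positivity, fun k hk => ?_⟩
    refine eventually_measure_not_le hbalP ?_ hε
    filter_upwards [eventually_ge_atTop k] with n hkn
    filter_upwards [huni] with ω hω hb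
    exact (hω repl k n hk hkn hb).1
  · intro hν2
    obtain ⟨m, hm, hS⟩ := tendsto_measure_not_sum_sq hν2 hz_meas hz_indep hz_law
    -- Here `m` is such that ∑ z² lies between (m / 2) n and 2 m n with probability tending to one;
    -- the event does not involve k, so neither do the constants.
    refine fun ε hε => ⟨σ ^ 2 / 2 * (1 / (2 * m)), σ ^ 2 / (1 - θ) * (1 / (m / 2)), by positivity,
      by positivity, fun k hk => ?_⟩
    refine eventually_measure_not_le (tendsto_measure_not_and hbalP hS) ?_ hε
    filter_upwards [eventually_ge_atTop k, eventually_gt_atTop 0] with n hkn hn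
    have hn0 : (0 : ℝ) < n := by exact_mod_cast hn
    filter_upwards [huni] with ω hω ⟨hb, hS1, hS2⟩
    obtain ⟨-, h1, h2⟩ := hω repl k n hk hkn hb
    have hSpos : 0 < ∑ i, firstTerms z n ω i ^ 2 := lt_of_lt_of_le (by positivity) hS1
    have h3 : 1 / (2 * m) ≤ n / ∑ i, firstTerms z n ω i ^ 2 := by
      rw [div_le_div_iff₀ (by positivity) hSpos]; linarith
    have h4 : n / ∑ i, firstTerms z n ω i ^ 2 ≤ 1 / (m / 2) := by
      rw [div_le_div_iff₀ hSpos (by positivity)]; linarith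
    exact ⟨le_trans (mul_le_mul_of_nonneg_right
        (mul_le_mul_of_nonneg_left h3 (by positivity)) (by positivity)) h1,
      h2.trans (mul_le_mul_of_nonneg_right
        (mul_le_mul_of_nonneg_left h4 (by positivity)) (by positivity))⟩
  · intro hν2 α hα k hk
    filter_upwards [huni, hbal, ae_tendsto_rpow_div_sum_sq hν hν2 hz_meas hz_indep hz_law hα]
      with ω hω hb hlim
    refine tendsto_atTop_mono' _ ?_ (hlim.const_mul_atTop (by positivity : 0 < σ ^ 2 / 2))
    filter_upwards [hb, eventually_ge_atTop k, eventually_gt_atTop 0] with n hb hkn hn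
    have hn0 : (0 : ℝ) < n := by exact_mod_cast hn
    have hk0 : (0 : ℝ) < k := by exact_mod_cast (by omega : 0 < k)
    refine le_trans (le_of_eq ?_) (mul_le_mul_of_nonneg_left (hω repl k n hk hkn hb).2.1
      (by positivity))
    -- The Gram matrix in B is an average, which gives an extra factor n and accounts for the
    -- exponent 2/ν - 1 in place of 2/ν.
    have hpow : (n : ℝ) ^ (2 / ν + α) = (n : ℝ) ^ (2 / ν - 1 + α) * n := by
      rw [← Real.rpow_add_one hn0.ne']
      congr 1; ring
    rw [hpow]
    field_simp
  · refine fun ε hε => ⟨σ ^ 2, σ ^ 2 / (1 - θ), by positivity, by positivity, ?_⟩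
    refine eventually_measure_not_le hbalP ?_ hε
    filter_upwards [eventually_gt_atTop 0] with n hn
    filter_upwards [hfull] with ω hω hb
    exact (hω n hn hb).1
  · intro hν2
    obtain ⟨m, hm, hS⟩ := tendsto_measure_not_sum_sq hν2 hz_meas hz_indep hz_law
    refine fun ε hε => ⟨σ ^ 2 * (1 / (2 * m)), σ ^ 2 / (1 - θ) * (1 / (m / 2)), by positivity,
      by positivity, ?_⟩
    refine eventually_measure_not_le (tendsto_measure_not_and hbalP hS) ?_ hε
    filter_upwards [eventually_gt_atTop 0] with n hn
    have hn0 : (0 : ℝ) < n := by exact_mod_cast hn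
    filter_upwards [hfull] with ω hω ⟨hb, hS1, hS2⟩
    obtain ⟨-, h1, h2⟩ := hω n hn hb
    have hSpos : 0 < ∑ i, firstTerms z n ω i ^ 2 := lt_of_lt_of_le (by positivity) hS1
    refine ⟨le_trans ?_ h1, h2.trans ?_⟩
    · rw [mul_assoc, one_div_mul_one_div]
      exact mul_le_mul_of_nonneg_left (one_div_le_one_div_of_le hSpos hS2) (by positivity)
    · rw [mul_assoc, one_div_mul_one_div]
      exact mul_le_mul_of_nonneg_left (one_div_le_one_div_of_le (by positivity) hS1)
        (by positivity)
  · intro hν2 α hα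
    filter_upwards [hfull, hbal, ae_tendsto_rpow_div_sum_sq hν hν2 hz_meas hz_indep hz_law hα]
      with ω hω hb hlim
    refine tendsto_atTop_mono' _ ?_ (hlim.const_mul_atTop (by positivity : 0 < σ ^ 2))
    filter_upwards [hb, eventually_gt_atTop 0] with n hb hn
    refine le_trans (le_of_eq ?_) (mul_le_mul_of_nonneg_left (hω n hn hb).2.1 (by positivity))
    ring
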